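/- Let $M$ be a smooth manifold of dimension $n+1$. A \emph{generalized Finsler structure} on $M$ is a pair $(\Sigma,\iota)$, where $\Sigma$ is a connected smooth manifold of dimension $2n+1$ and $\iota:\Sigma\to TM$ is a smooth immersion transverse to the orbits of scalar multiplication, such that $p=\pi\circ\iota:\Sigma\to M$ is a submersion with connected fibers and, for each $x\in M$, the map $\iota_x:\Sigma_x=p^{-1}(x)\to T_xM$ immerses $\Sigma_x$ as a hypersurface that is locally strictly convex towards $0_x$ (its centro-affine second fundamental form is positive definite). The Hilbert form on $\Sigma$ is $(\omega_0)_u=p^*(u^*)$, where $u^*\in T^*_{p(u)}M$ is the covector with $u^*(\iota(u))=1$ whose kernel is the hyperplane $\iota_x'(T_u\Sigma_x)\subset T_xM$, $x=p(u)$. Indices $i,j,k$ run from $1$ to $n$ and repeated indices are summed. Let $F\to\Sigma$ be the canonical $\mathrm O(n)$-structure of $(\Sigma,\iota)$: the embedded submanifold of the coframe bundle of $\Sigma$ that consists of the values of all local coframings $(\omega_0,\omega_i,\theta_{0i})$ in which $\omega_0$ is the Hilbert form, the $\omega_i$ vanish on the fibers $\Sigma_x$, and $$d\omega_0=-\theta_{0j}\wedge\omega_j,\qquad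 d\omega_i=\theta_{0i}\wedge\omega_0-\theta_{ij}\wedge\omega_j-I_{ijk}\,\theta_{0k}\wedge\omega_j \tag{$*$}$$ for some $1$-forms $\theta_{ij}=-\theta_{ji}$ and functions $I_{ijk}=I_{jik}$. Write $\omega_0,\omega_i,\theta_{0i}$ also for the tautological forms on $F$, and let $\theta_{ij}=-\theta_{ji}$ and $I_{ijk}=I_{jik}$ be the (uniquely determined) connection forms and functions on $F$ for which the second equation of $(*)$ holds on $F$. Then $\omega_0,\omega_i,\theta_{0i},\theta_{ij}$ $(i<j)$ is a coframing of $F$. Let $R_{0i0j}$, $R_{0ijk}=-R_{0ikj}$ and $J_{ijk}$ be the functions on $F$ defined by $$d\theta_{0i}=-\theta_{0j}\wedge\theta_{ji}+R_{0i0j}\,\omega_0\wedge\omega_j+\tfrac12R_{0ijk}\,\omega_j\wedge\omega_k+J_{ijk}\,\theta_{0k}\wedge\omega_j ;$$ that is, if $E,e_i,f_i$ are the vector fields on $F$ dual to $\omega_0,\omega_i,\theta_{0i}$ in this coframing, then $R_{0i0j}=d\theta_{0i}(E,e_j)$, $R_{0ijk}=d\theta_{0i}(e_j,e_k)$ and $J_{ijk}=d\theta_{0i}(f_k,e_j)$.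 The field $E$, determined by $\omega_0(E)=1$ and $\omega_i(E)=\theta_{0i}(E)=\theta_{ij}(E)=0$, is the lift to $F$ of the Reeb field. A dot denotes the Lie derivative along $E$. Suppose that $(\Sigma,\iota)$ has constant flag curvature $c\in\mathbb R$, i.e. $R_{0i0j}\,\omega_i\circ\omega_j=c\,(\omega_1^2+\dots+\omega_n^2)$. Then the following identities hold on $F$ for all $i,j,k$: \begin{enumerate} \item $\dot\omega_i=-\theta_{0i}$ and $\dot\theta_{0i}=c\,\omega_i$; \item $J_{ijk}$ is differentiable, $\dot I_{ijk}=J_{ijk}$ and $\dot J_{ijk}=-c\,I_{ijk}$; \item $R_{0ijk}=0$; \item $\dot\theta_{ij}=0$. \end{enumerate} In particular, $J_{ijk}$ is fully symmetric in its indices. -/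

import Mathlib

open scoped Manifold ContDiff Bundle
open Bundle

noncomputable section

/-! ### One-forms and vector fields on a smooth manifold without boundary -/

namespace FinslerReeb

section Forms

variable {H : Type*} [NormedAddCommGroup H] [NormedSpace ℝ H]
variable {X : Type*} [TopologicalSpace X] [ChartedSpace H X]

variable (H X) in
/-- (Not necessarily smooth) one-forms on `X`. -/
abbrev OneForm := ∀ x : X, TangentSpace 𝓘(ℝ, H) x →L[ℝ] ℝ

variable (H X) in
/-- (Not necessarily smooth) vector fields on `X`. -/
abbrev VField := ∀ x : X, TangentSpace 𝓘(ℝ, H) x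

/-- Smoothness on `U` of a one-form with values in `V`, as a section of the bundle
`Hom(TX, V)`. -/
def SmoothFormOn [IsManifold 𝓘(ℝ, H) ∞ X] {V : Type*} [NormedAddCommGroup V] [NormedSpace ℝ V]
    (U : Set X) (α : ∀ x : X, TangentSpace 𝓘(ℝ, H) x →L[ℝ] V) : Prop :=
  ContMDiffOn 𝓘(ℝ, H) (𝓘(ℝ, H).prod 𝓘(ℝ, H →L[ℝ] V)) ∞
    (fun x => (TotalSpace.mk' (H →L[ℝ] V) x (α x) :
      TotalSpace (H →L[ℝ] V)
        (fun x : X => TangentSpace 𝓘(ℝ, H) x →L[ℝ] Bundle.Trivial X V x))) U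

/-- Smoothness of a vector field, as a section of the tangent bundle. -/
def SmoothVField [IsManifold 𝓘(ℝ, H) ∞ X] (Y : VField H X) : Prop :=
  ContMDiff 𝓘(ℝ, H) 𝓘(ℝ, H).tangent ∞ (fun x => (⟨x, Y x⟩ : TangentBundle 𝓘(ℝ, H) X))

/-- The expression of a one-form in the preferred chart around `p`. -/
def formInChart (α : OneForm H X) (p : X) : H → (H →L[ℝ] ℝ) := fun y =>
  (α ((extChartAt 𝓘(ℝ, H) p).symm y)).comp
    (mfderiv 𝓘(ℝ, H) 𝓘(ℝ, H) (extChartAt 𝓘(ℝ, H) p).symm y)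

/-- The expression of a vector field in the preferred chart around `p`. -/
def fieldInChart (Y : VField H X) (p : X) : H → H := fun y =>
  mfderiv 𝓘(ℝ, H) 𝓘(ℝ, H) (extChartAt 𝓘(ℝ, H) p) ((extChartAt 𝓘(ℝ, H) p).symm y)
    (Y ((extChartAt 𝓘(ℝ, H) p).symm y))

/-- The exterior derivative `dα` of a one-form, computed in the preferred chart around `p`;
`dα (v, w) = D_v α (w) - D_w α (v)`. -/
def dExt (α : OneForm H X) (p : X) (v w : TangentSpace 𝓘(ℝ, H) p) : ℝ :=
  extDeriv (fun y => ContinuousAlternatingMap.ofSubsingleton ℝ H ℝ (0 : Fin 1)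
      (formInChart α p y))
    (extChartAt 𝓘(ℝ, H) p p)
    ![(mfderiv 𝓘(ℝ, H) 𝓘(ℝ, H) (extChartAt 𝓘(ℝ, H) p) p v : H),
      (mfderiv 𝓘(ℝ, H) 𝓘(ℝ, H) (extChartAt 𝓘(ℝ, H) p) p w : H)]

/-- The wedge product of two covectors: `(a ∧ b) (v, w) = a v * b w - a w * b v`. -/
def wedge {T : Type*} [AddCommGroup T] [Module ℝ T] [TopologicalSpace T]
    (a b : T →L[ℝ] ℝ) (v w : T) : ℝ :=
  a v * b w - a w * b v

/-- The Lie derivative `L_Y α` of a one-form along a vector field, computed in the preferred chart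
around `p`: `(L_Y α)_j = Y^k ∂_k α_j + α_k ∂_j Y^k`. -/
def lieForm (Y : VField H X) (α : OneForm H X) (p : X) (v : TangentSpace 𝓘(ℝ, H) p) : ℝ :=
  let y₀ : H := extChartAt 𝓘(ℝ, H) p p
  let v' : H := mfderiv 𝓘(ℝ, H) 𝓘(ℝ, H) (extChartAt 𝓘(ℝ, H) p) p v
  fderiv ℝ (formInChart α p) y₀ (fieldInChart Y p y₀) v' +
    formInChart α p y₀ (fderiv ℝ (fieldInChart Y p) y₀ v')

/-- The Lie derivative of a function along a vector field. -/
def lieFun (Y : VField H X) (g : X → ℝ) (p : X) : ℝ :=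
  (mfderiv 𝓘(ℝ, H) 𝓘(ℝ, ℝ) g p (Y p) : ℝ)

/-- On the set `U`, the one-forms `θ i j` are smooth and skew in `i, j`, the functions `I i j k`
are smooth and symmetric in `i, j`, and
`dω_i = θ_{0i} ∧ ω_0 - θ_{ij} ∧ ω_j - I_{ijk} θ_{0k} ∧ ω_j`.
If `ω_0, ω_i, θ_{0i}` are pointwise linearly independent on an open set `U`,
then there is at most one such pair `(θ, I)` on `U`. -/
structure IsConnection [IsManifold 𝓘(ℝ, H) ∞ X] {n : ℕ} (U : Set X)
    (om₀ : OneForm H X) (om th₀ : Fin n → OneForm H X)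
    (θ : Fin n → Fin n → OneForm H X) (I : Fin n → Fin n → Fin n → X → ℝ) : Prop where
  smooth_form : ∀ i j, SmoothFormOn U (θ i j)
  smooth_fun : ∀ i j k, ContMDiffOn 𝓘(ℝ, H) 𝓘(ℝ, ℝ) ∞ (I i j k) U
  skew : ∀ i j, ∀ x ∈ U, θ i j x = -θ j i x
  symm : ∀ i j k, ∀ x ∈ U, I i j k x = I j i k x
  d_omega : ∀ i, ∀ x ∈ U, ∀ v w, dExt (om i) x v w =
    wedge (th₀ i x) (om₀ x) v w - ∑ j, wedge (θ i j x) (om j x) v w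
      - ∑ j, ∑ k, I i j k x * wedge (th₀ k x) (om j x) v w

/-- `E, e_i, f_i` are the smooth vector fields dual to `ω_0, ω_i, θ_{0i}` in the coframing
`ω_0, ω_i, θ_{0i}, θ_{ij}` (`i < j`). -/
structure IsDualFrame [IsManifold 𝓘(ℝ, H) ∞ X] {n : ℕ}
    (om₀ : OneForm H X) (om th₀ : Fin n → OneForm H X) (θ : Fin n → Fin n → OneForm H X)
    (E : VField H X) (e f : Fin n → VField H X) : Prop where
  smooth_E : SmoothVField E
  smooth_e : ∀ i, SmoothVField (e i)
  smooth_f : ∀ i, SmoothVField (f i)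
  omega0_E : ∀ x, om₀ x (E x) = 1
  omega_E : ∀ i x, om i x (E x) = 0
  theta0_E : ∀ i x, th₀ i x (E x) = 0
  theta_E : ∀ i j x, θ i j x (E x) = 0
  omega0_e : ∀ j x, om₀ x (e j x) = 0
  omega_e : ∀ i j x, om i x (e j x) = if i = j then 1 else 0
  theta0_e : ∀ i j x, th₀ i x (e j x) = 0
  theta_e : ∀ i k j x, θ i k x (e j x) = 0
  omega0_f : ∀ j x, om₀ x (f j x) = 0
  omega_f : ∀ i j x, om i x (f j x) = 0
  theta0_f : ∀ i j x, th₀ i x (f j x) = if i = j then 1 else 0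
  theta_f : ∀ i k j x, θ i k x (f j x) = 0

/-- `R_{0i0j}`: the coefficient of `ω_0 ∧ ω_j` in `dθ_{0i}`. -/
def curvR00 {n : ℕ} (th₀ : Fin n → OneForm H X) (E : VField H X) (e : Fin n → VField H X)
    (i j : Fin n) (x : X) : ℝ :=
  dExt (th₀ i) x (E x) (e j x)

/-- `R_{0ijk}`: the coefficient of `ω_j ∧ ω_k` in `dθ_{0i}` (written `½ R_{0ijk} ω_j ∧ ω_k`
with a sum over all `j, k`). -/
def curvR0 {n : ℕ} (th₀ : Fin n → OneForm H X) (e : Fin n → VField H X)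
    (i j k : Fin n) (x : X) : ℝ :=
  dExt (th₀ i) x (e j x) (e k x)

/-- `J_{ijk}`: the coefficient of `θ_{0k} ∧ ω_j` in `dθ_{0i}`. -/
def coeffJ {n : ℕ} (th₀ : Fin n → OneForm H X) (e f : Fin n → VField H X)
    (i j k : Fin n) (x : X) : ℝ :=
  dExt (th₀ i) x (f k x) (e j x)

/-- The flag curvature is the constant `c`: as quadratic forms,
`R_{0i0j} ω_i ω_j = c (ω_1² + ⋯ + ω_n²)`. -/
def HasConstFlagCurvature {n : ℕ} (om th₀ : Fin n → OneForm H X)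
    (E : VField H X) (e : Fin n → VField H X) (c : ℝ) : Prop :=
  ∀ (x : X) (v : TangentSpace 𝓘(ℝ, H) x),
    ∑ i, ∑ j, curvR00 th₀ E e i j x * (om i x v * om j x v) = c * ∑ i, (om i x v) ^ 2

end Forms

/-! ### Generalized Finsler structures -/

section Finsler

variable {n : ℕ}
variable {M : Type*} [TopologicalSpace M] [ChartedSpace (EuclideanSpace ℝ (Fin (n + 1))) M]
  [IsManifold (𝓡 (n + 1)) ∞ M]
variable {S : Type*} [TopologicalSpace S] [ChartedSpace (EuclideanSpace ℝ (Fin (2 * n + 1))) S]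
  [IsManifold (𝓡 (2 * n + 1)) ∞ S]

/-- The vertical lift of `z ∈ T_x M` at `v ∈ T_x M`: the velocity at `t = 0` of `t ↦ v + t z`. -/
def verticalLift (v : TangentBundle (𝓡 (n + 1)) M) (z : TangentSpace (𝓡 (n + 1)) v.proj) :
    TangentSpace (𝓡 (n + 1)).tangent v :=
  mfderiv 𝓘(ℝ, ℝ) (𝓡 (n + 1)).tangent
    (fun t : ℝ => (⟨v.proj, v.2 + t • z⟩ : TangentBundle (𝓡 (n + 1)) M)) 0 (1 : ℝ)

/-- `z ∈ T_x M`, where `ι u ∈ T_x M`, lies in the image of the tangent space at `u` of the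
fibre `S_x` under the differential of `ι_x : S_x → T_x M`. -/
def IsFibreTangent (ι : S → TangentBundle (𝓡 (n + 1)) M) (u : S)
    (z : TangentSpace (𝓡 (n + 1)) (ι u).proj) : Prop :=
  ∃ w : TangentSpace (𝓡 (2 * n + 1)) u,
    mfderiv (𝓡 (2 * n + 1)) (𝓡 (n + 1)) (fun s => (ι s).proj) u w = 0 ∧
    mfderiv (𝓡 (2 * n + 1)) (𝓡 (n + 1)).tangent ι u w = verticalLift (ι u) z

/-- The covector `ξ ∈ T_x^* M` with `ξ (ι u) = 1` whose kernel is the image of the tangent space of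
the fibre. -/
def IsDualCovector (ι : S → TangentBundle (𝓡 (n + 1)) M) (u : S)
    (ξ : TangentSpace (𝓡 (n + 1)) (ι u).proj →L[ℝ] ℝ) : Prop :=
  ξ (ι u).2 = 1 ∧ ∀ z, ξ z = 0 ↔ IsFibreTangent ι u z

/-- The covector of `IsDualCovector` (which exists and is unique for a generalized Finsler
structure). -/
def dualCovector (ι : S → TangentBundle (𝓡 (n + 1)) M) (u : S) :
    TangentSpace (𝓡 (n + 1)) (ι u).proj →L[ℝ] ℝ :=
  Classical.epsilon (IsDualCovector ι u)

/-- The Hilbert form `ω_0` on `S`. -/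
def hilbertForm (ι : S → TangentBundle (𝓡 (n + 1)) M) :
    OneForm (EuclideanSpace ℝ (Fin (2 * n + 1))) S := fun u =>
  (dualCovector ι u).comp (mfderiv (𝓡 (2 * n + 1)) (𝓡 (n + 1)) (fun s => (ι s).proj) u)

/-- `(S, ι)` is a generalized Finsler structure on `M`. -/
structure IsGenFinsler (ι : S → TangentBundle (𝓡 (n + 1)) M) : Prop where
  connected : ConnectedSpace S
  smooth : ContMDiff (𝓡 (2 * n + 1)) (𝓡 (n + 1)).tangent ∞ ι
  immersion : ∀ u, Function.Injective (mfderiv (𝓡 (2 * n + 1)) (𝓡 (n + 1)).tangent ι u)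
  /-- The image of `dι_u` does not contain the radial vector at `ι u`; as `dim TM = dim S + 1`,
  this is transversality to the orbits of scalar multiplication. -/
  radially_transverse : ∀ u, ∀ w : TangentSpace (𝓡 (2 * n + 1)) u,
    mfderiv (𝓡 (2 * n + 1)) (𝓡 (n + 1)).tangent ι u w ≠ verticalLift (ι u) (ι u).2
  submersion : ∀ u, Function.Surjective
    (mfderiv (𝓡 (2 * n + 1)) (𝓡 (n + 1)) (fun s => (ι s).proj) u)
  connected_fibres : ∀ x : M, IsPreconnected {u : S | (ι u).proj = x}
  /-- Each immersed hypersurface `ι_x : S_x → T_x M` is locally strictly convex towards `0`: every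
  curve `c = ι ∘ σ` in it accelerates to the side of its tangent hyperplane that contains `0`
  whenever its velocity is non-zero (i.e. the centro-affine second fundamental form is
  positive definite). -/
  convex : ∀ (u : S) (σ : ℝ → S) (c : ℝ → TangentSpace (𝓡 (n + 1)) (ι u).proj),
    ContMDiff 𝓘(ℝ, ℝ) (𝓡 (2 * n + 1)) ∞ σ → σ 0 = u →
    (∀ t, ι (σ t) = ⟨(ι u).proj, c t⟩) →
    mfderiv 𝓘(ℝ, ℝ) (𝓡 (2 * n + 1)) σ 0 (1 : ℝ) ≠ 0 →
    dualCovector ι u (deriv (deriv c) 0) < 0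

/-- Values `(ω_0, (ω_i), (θ_i))` of coframes in dimension `2n+1`. -/
abbrev CoframeSpace (n : ℕ) := ℝ × (Fin n → ℝ) × (Fin n → ℝ)

/-- The component `ω_0`. -/
abbrev proj0 (n : ℕ) : CoframeSpace n →L[ℝ] ℝ := ContinuousLinearMap.fst ℝ ℝ _

/-- The component `ω_i`. -/
abbrev projω {n : ℕ} (i : Fin n) : CoframeSpace n →L[ℝ] ℝ :=
  (ContinuousLinearMap.proj i).comp
    ((ContinuousLinearMap.fst ℝ (Fin n → ℝ) (Fin n → ℝ)).comp (ContinuousLinearMap.snd ℝ ℝ _))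

/-- The component `θ_i`. -/
abbrev projθ {n : ℕ} (i : Fin n) : CoframeSpace n →L[ℝ] ℝ :=
  (ContinuousLinearMap.proj i).comp
    ((ContinuousLinearMap.snd ℝ (Fin n → ℝ) (Fin n → ℝ)).comp (ContinuousLinearMap.snd ℝ ℝ _))

/-- `η = (ω_0, ω_i, θ_i)` is an adapted coframing on the open set `U`: it is a smooth coframing,
`ω_0` is the Hilbert form, the `ω_i` vanish on the fibres `S_x`, and
`dω_0 = -θ_j ∧ ω_j`, `dω_i = θ_i ∧ ω_0 - θ_{ij} ∧ ω_j - I_{ijk} θ_k ∧ ω_j`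
for some one-forms `θ_{ij} = -θ_{ji}` and functions `I_{ijk} = I_{jik}` on `U`. -/
structure IsAdaptedCoframing (ι : S → TangentBundle (𝓡 (n + 1)) M) (U : Set S)
    (η : ∀ u : S, TangentSpace (𝓡 (2 * n + 1)) u →L[ℝ] CoframeSpace n) : Prop where
  isOpen : IsOpen U
  smooth : SmoothFormOn U η
  bijective : ∀ u ∈ U, Function.Bijective (η u)
  hilbert : ∀ u ∈ U, (proj0 n).comp (η u) = hilbertForm ι u
  vanish : ∀ u ∈ U, ∀ w : TangentSpace (𝓡 (2 * n + 1)) u,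
    mfderiv (𝓡 (2 * n + 1)) (𝓡 (n + 1)) (fun s => (ι s).proj) u w = 0 →
      ∀ i, projω i (η u w) = 0
  d_omega0 : ∀ u ∈ U, ∀ v w, dExt (fun s => (proj0 n).comp (η s)) u v w =
    -∑ j, wedge ((projθ j).comp (η u)) ((projω j).comp (η u)) v w
  d_omega : ∃ (θ : Fin n → Fin n → OneForm (EuclideanSpace ℝ (Fin (2 * n + 1))) S)
      (I : Fin n → Fin n → Fin n → S → ℝ),
    IsConnection U (fun s => (proj0 n).comp (η s)) (fun i s => (projω i).comp (η s))
      (fun i s => (projθ i).comp (η s)) θ I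

variable (n S) in
/-- The total space of the bundle `Hom(TS, ℝ^{2n+1})`, which contains the coframe bundle of `S`
as an open subset. -/
abbrev HomBundle :=
  TotalSpace (EuclideanSpace ℝ (Fin (2 * n + 1)) →L[ℝ] CoframeSpace n)
    (fun u : S => TangentSpace (𝓡 (2 * n + 1)) u →L[ℝ] Bundle.Trivial S (CoframeSpace n) u)

variable (n) in
/-- The model with corners of `HomBundle n S`. -/
abbrev homModel :=
  (𝓡 (2 * n + 1)).prod 𝓘(ℝ, EuclideanSpace ℝ (Fin (2 * n + 1)) →L[ℝ] CoframeSpace n)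

/-- The `O(n)`-structure `F → S` of `(S, ι)`: the set of the values at points of `S` of local
adapted coframings. -/
def structureBundle (ι : S → TangentBundle (𝓡 (n + 1)) M) : Set (HomBundle n S) :=
  {φ | ∃ (U : Set S) (η : ∀ u : S, TangentSpace (𝓡 (2 * n + 1)) u →L[ℝ] CoframeSpace n),
    IsAdaptedCoframing ι U η ∧ φ.proj ∈ U ∧ φ.2 = η φ.proj}

/-- The dimension `2n + 1 + n(n-1)/2` of the `O(n)`-structure. -/
abbrev bundleDim (n : ℕ) : ℕ := 2 * n + 1 + n.choose 2

variable (ι : S → TangentBundle (𝓡 (n + 1)) M)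
  [ChartedSpace (EuclideanSpace ℝ (Fin (bundleDim n))) (structureBundle ι)]

/-- The tautological form `(ω_0, ω_i, θ_{0i})` on `F`: at `φ ∈ F` it is the pull-back of the
coframe `φ` under the projection `F → S`. -/
def tautForm (φ : structureBundle ι) :
    TangentSpace (𝓡 (bundleDim n)) φ →L[ℝ] CoframeSpace n :=
  ContinuousLinearMap.comp
    (φ.1.2 : TangentSpace (𝓡 (2 * n + 1)) φ.1.proj →L[ℝ] CoframeSpace n)
    (mfderiv (𝓡 (bundleDim n)) (𝓡 (2 * n + 1)) (fun ψ : structureBundle ι => ψ.1.proj) φ)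

/-- The form `ω_0` on `F`. -/
def omega0 : OneForm (EuclideanSpace ℝ (Fin (bundleDim n))) (structureBundle ι) :=
  fun φ => (proj0 n).comp (tautForm ι φ)

/-- The forms `ω_i` on `F`. -/
def omega (i : Fin n) : OneForm (EuclideanSpace ℝ (Fin (bundleDim n))) (structureBundle ι) :=
  fun φ => (projω i).comp (tautForm ι φ)

/-- The forms `θ_{0i}` on `F`. -/
def theta0 (i : Fin n) : OneForm (EuclideanSpace ℝ (Fin (bundleDim n))) (structureBundle ι) :=
  fun φ => (projθ i).comp (tautForm ι φ)

end Finsler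

end FinslerReeb

end
open FinslerReeb

/-!
The structure equations and `d² = 0` force all the identities; no global geometry enters.

On `F` the form `ω_0` is the pull-back of the Hilbert form, so `dω_0 = -θ_{0j} ∧ ω_j` holds there
as it does for local adapted coframings (`dExt_omega0`). Since the exterior derivative commutes
with pull-backs (`dExt_pullback`), it can be computed near a point `p` in the single chart around
`p`, and everything reduces to forms and fields on an open subset of a normed space
(`FlatStructure`, `flatStructure_chart`). As `ω_i, θ_{0i}, θ_{ij}` are constant on the Reeb field
`E`, their Lie derivatives along `E` are `i_E dω_i`, `i_E dθ_{0i}` and `i_E dθ_{ij}`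
(`lieForm_eq_flatD`).

The equation `d²ω_0 = 0` determines `dθ_{0i}` on the common kernel of the `ω_j` and shows that
`R_{0i0j}` is symmetric and `J_{ijk}` symmetric in `i, j`. Comparison with `d²ω_i = 0` gives the
symmetry of `I_{ijk}` in `j, k`, and, by playing symmetric expressions against skew ones,
`dθ_{0i}(A, e_j) = 0` and `dθ_{ij}(E, A) = 0` for vectors `A` annihilated by `ω_0, ω_i, θ_{0i}`,
as well as `dθ_{ij}(E, f_k) = 0` and `E(I_{ijk}) = J_{ijk}`. Hence `i_E dθ_{0i} = c ω_i`.

Put `T_{ijk} = dθ_{ij}(E, e_k)`, which is skew in `i, j`. Then `d²ω_i = 0` gives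
`R_{0ijk} = T_{ikj} - T_{ijk}`, and `d²θ_{0i} = 0`, evaluated on the fields `E, f_k, e_j`, gives
`E(J_{ijk}) + c I_{ijk} = T_{ijk} + 2 T_{kij}`. The left side is symmetric in all indices, which
is only possible if `T = 0` (`FlatStructure.d_t_E_e`). So `R_{0ijk} = 0`, `E(J_{ijk}) = -c I_{ijk}`
and `i_E dθ_{ij} = 0`. Linear independence of the `θ_{ij}` is never needed: the arguments apply to
all vectors `A` as above.
-/

namespace FinslerReeb

/-! ### Exterior calculus of one-forms on a normed space -/

section Flat

variable {H : Type*} [NormedAddCommGroup H] [NormedSpace ℝ H]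

/-- The exterior derivative of a one-form on a normed space,
`dα (v, w) = D_v α (w) - D_w α (v)`. -/
noncomputable def flatD (α : H → H →L[ℝ] ℝ) (y v w : H) : ℝ := fderiv ℝ α y v w - fderiv ℝ α y w v

/-- The three-form `d (α ∧ β) = dα ∧ β - α ∧ dβ`. -/
noncomputable def flatDWedge (α β : H → H →L[ℝ] ℝ) (y u v w : H) : ℝ :=
  (flatD α y u v * β y w - α y u * flatD β y v w) +
  (flatD α y v w * β y u - α y v * flatD β y w u) +
  (flatD α y w u * β y v - α y w * flatD β y u v)

lemma flatD_swap (α : H → H →L[ℝ] ℝ) (y v w : H) : flatD α y v w = -flatD α y w v := by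
  simp [flatD]

lemma flatD_add_left (α : H → H →L[ℝ] ℝ) (y v v' w : H) :
    flatD α y (v + v') w = flatD α y v w + flatD α y v' w := by
  simp only [flatD, map_add, add_apply]; ring

lemma flatD_smul_left (α : H → H →L[ℝ] ℝ) (y : H) (r : ℝ) (v w : H) :
    flatD α y (r • v) w = r * flatD α y v w := by
  simp [flatD]; ring

lemma flatD_sum_left {κ : Type*} (s : Finset κ) (α : H → H →L[ℝ] ℝ) (y : H) (v : κ → H) (w : H) :
    flatD α y (∑ k ∈ s, v k) w = ∑ k ∈ s, flatD α y (v k) w := by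
  simp [flatD, Finset.sum_sub_distrib]

lemma two_le_infty : (2 : WithTop ℕ∞) ≤ ∞ := by
  exact WithTop.coe_le_coe.2 (le_top : (2 : ℕ∞) ≤ ⊤)

lemma differentiableAt_fderiv {F : Type*} [NormedAddCommGroup F] [NormedSpace ℝ F] {α : H → F}
    {y : H} (hα : ContDiffAt ℝ ∞ α y) : DifferentiableAt ℝ (fderiv ℝ α) y :=
  (hα.fderiv_right (m := 1) (by rw [one_add_one_eq_two]; exact two_le_infty)).differentiableAt one_ne_zero

/-- The product rule for `dα (V, W)` with fields `V, W`. -/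
lemma fderiv_flatD {α : H → H →L[ℝ] ℝ} {y : H} (hα : ContDiffAt ℝ ∞ α y) {V W : H → H}
    (hV : DifferentiableAt ℝ V y) (hW : DifferentiableAt ℝ W y) (u : H) :
    fderiv ℝ (fun z => flatD α z (V z) (W z)) y u =
      fderiv ℝ (fun z => flatD α z (V y) (W y)) y u +
        flatD α y (fderiv ℝ V y u) (W y) + flatD α y (V y) (fderiv ℝ W y u) := by
  have h := differentiableAt_fderiv hα
  have key : ∀ V W : H → H, DifferentiableAt ℝ V y → DifferentiableAt ℝ W y →
      HasFDerivAt (fun z => fderiv ℝ α z (V z) (W z)) _ y := fun V W hV hW =>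
    (h.hasFDerivAt.clm_apply hV.hasFDerivAt).clm_apply hW.hasFDerivAt
  unfold flatD
  rw [((key V W hV hW).fun_sub (key W V hW hV)).fderiv,
    ((key _ _ (differentiableAt_const (V y)) (differentiableAt_const (W y))).fun_sub
      (key _ _ (differentiableAt_const (W y)) (differentiableAt_const (V y)))).fderiv]
  simp
  ring

lemma differentiableAt_flatD {α : H → H →L[ℝ] ℝ} {y : H} (hα : ContDiffAt ℝ ∞ α y) {V W : H → H}
    (hV : DifferentiableAt ℝ V y) (hW : DifferentiableAt ℝ W y) :
    DifferentiableAt ℝ (fun z => flatD α z (V z) (W z)) y := by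
  have h := differentiableAt_fderiv hα
  unfold flatD
  exact ((h.clm_apply hV).clm_apply hW).sub ((h.clm_apply hW).clm_apply hV)

/-- `d² = 0` on one-forms. -/
lemma flatD_closed {α : H → H →L[ℝ] ℝ} {y : H} (hα : ContDiffAt ℝ ∞ α y) (u v w : H) :
    fderiv ℝ (fun z => flatD α z v w) y u + fderiv ℝ (fun z => flatD α z w u) y v +
      fderiv ℝ (fun z => flatD α z u v) y w = 0 := by
  have h := differentiableAt_fderiv hα
  have key : ∀ u v w : H, fderiv ℝ (fun z => flatD α z v w) y u =
      fderiv ℝ (fderiv ℝ α) y u v w - fderiv ℝ (fderiv ℝ α) y u w v := by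
    intro u v w
    have h1 : ∀ v w : H, HasFDerivAt (fun z => fderiv ℝ α z v w) _ y := fun v w =>
      (h.hasFDerivAt.clm_apply (hasFDerivAt_const v y)).clm_apply (hasFDerivAt_const w y)
    unfold flatD
    rw [((h1 v w).fun_sub (h1 w v)).fderiv]
    simp
  have hs : IsSymmSndFDerivAt ℝ α y := hα.isSymmSndFDerivAt (by simpa using two_le_infty)
  rw [key, key, key, hs.eq u v, hs.eq v w, hs.eq w u]
  ring

lemma fderiv_wedge {α β : H → H →L[ℝ] ℝ} {y : H} (hα : DifferentiableAt ℝ α y)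
    (hβ : DifferentiableAt ℝ β y) (u v w : H) :
    fderiv ℝ (fun z => wedge (α z) (β z) v w) y u =
      fderiv ℝ α y u v * β y w + α y v * fderiv ℝ β y u w
        - fderiv ℝ α y u w * β y v - α y w * fderiv ℝ β y u v := by
  have h1 : ∀ α : H → H →L[ℝ] ℝ, DifferentiableAt ℝ α y → ∀ v : H,
      HasFDerivAt (fun z => α z v) _ y := fun α hα v =>
    hα.hasFDerivAt.clm_apply (hasFDerivAt_const v y)
  unfold wedge
  rw [(((h1 α hα v).fun_mul (h1 β hβ w)).fun_sub ((h1 α hα w).fun_mul (h1 β hβ v))).fderiv]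
  simp
  ring

lemma differentiableAt_wedge {α β : H → H →L[ℝ] ℝ} {y : H} (hα : DifferentiableAt ℝ α y)
    (hβ : DifferentiableAt ℝ β y) (v w : H) :
    DifferentiableAt ℝ (fun z => wedge (α z) (β z) v w) y := by
  unfold wedge
  exact ((hα.clm_apply (differentiableAt_const v)).mul
    (hβ.clm_apply (differentiableAt_const w))).sub
    ((hα.clm_apply (differentiableAt_const w)).mul (hβ.clm_apply (differentiableAt_const v)))

/-- The Leibniz rule for the exterior derivative of `α ∧ β`. -/
lemma cyclic_fderiv_wedge {α β : H → H →L[ℝ] ℝ} {y : H} (hα : DifferentiableAt ℝ α y)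
    (hβ : DifferentiableAt ℝ β y) (u v w : H) :
    fderiv ℝ (fun z => wedge (α z) (β z) v w) y u + fderiv ℝ (fun z => wedge (α z) (β z) w u) y v +
      fderiv ℝ (fun z => wedge (α z) (β z) u v) y w = flatDWedge α β y u v w := by
  simp only [fderiv_wedge hα hβ, flatDWedge, flatD]
  ring

/-- `α ([V, W]) = V (α W) - W (α V) - dα (V, W)`. -/
lemma apply_lieBracket {α : H → H →L[ℝ] ℝ} {y : H} (hα : DifferentiableAt ℝ α y) {V W : H → H}
    (hV : DifferentiableAt ℝ V y) (hW : DifferentiableAt ℝ W y) :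
    α y (VectorField.lieBracket ℝ V W y) = fderiv ℝ (fun z => α z (W z)) y (V y) -
      fderiv ℝ (fun z => α z (V z)) y (W y) - flatD α y (V y) (W y) := by
  rw [fderiv_clm_apply hα hW, fderiv_clm_apply hα hV]
  simp [VectorField.lieBracket, flatD]
  ring

/-- `d² = 0`, evaluated on three vector fields. -/
lemma flatD_closed_fields {α : H → H →L[ℝ] ℝ} {y : H} (hα : ContDiffAt ℝ ∞ α y) {U V W : H → H}
    (hU : DifferentiableAt ℝ U y) (hV : DifferentiableAt ℝ V y) (hW : DifferentiableAt ℝ W y) :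
    fderiv ℝ (fun z => flatD α z (V z) (W z)) y (U y) +
      fderiv ℝ (fun z => flatD α z (W z) (U z)) y (V y) +
      fderiv ℝ (fun z => flatD α z (U z) (V z)) y (W y) =
    flatD α y (VectorField.lieBracket ℝ U V y) (W y) +
      flatD α y (VectorField.lieBracket ℝ V W y) (U y) +
      flatD α y (VectorField.lieBracket ℝ W U y) (V y) := by
  have h := flatD_closed hα (U y) (V y) (W y)
  rw [fderiv_flatD hα hV hW, fderiv_flatD hα hW hU, fderiv_flatD hα hU hV]
  simp only [VectorField.lieBracket, sub_eq_add_neg, flatD_add_left, ← neg_one_smul ℝ (fderiv ℝ _ _ _),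
    flatD_smul_left]
  rw [flatD_swap α y (V y), flatD_swap α y (W y), flatD_swap α y (U y)]
  linarith

lemma flatD_congr {α β : H → H →L[ℝ] ℝ} {y : H} (h : α =ᶠ[nhds y] β) (v w : H) :
    flatD α y v w = flatD β y v w := by
  rw [flatD, flatD, h.fderiv_eq]

/-- The exterior derivative of a one-form on a normed space commutes with pull-backs. -/
lemma flatD_pullback {H' : Type*} [NormedAddCommGroup H'] [NormedSpace ℝ H']
    {β : H' → H' →L[ℝ] ℝ} {g : H → H'} {y : H} (hβ : DifferentiableAt ℝ β (g y))
    (hg : ContDiffAt ℝ ∞ g y) (v w : H) :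
    flatD (fun z => (β (g z)).comp (fderiv ℝ g z)) y v w =
      flatD β (g y) (fderiv ℝ g y v) (fderiv ℝ g y w) := by
  have hs : IsSymmSndFDerivAt ℝ g y := hg.isSymmSndFDerivAt (by simpa using two_le_infty)
  have hc : HasFDerivAt (fun z => β (g z)) _ y :=
    hβ.hasFDerivAt.comp y (hg.differentiableAt (by simp)).hasFDerivAt
  rw [flatD, (hc.clm_comp (differentiableAt_fderiv hg).hasFDerivAt).fderiv]
  simp [flatD, hs.eq v w]

end Flat

/-! ### The structure equations on an open subset of a normed space -/

section Structure

variable {H : Type*} [NormedAddCommGroup H] [NormedSpace ℝ H] {n : ℕ}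

/-- The structure equations of a generalized Finsler structure, written on an open subset `U` of
a normed space: the forms `ω_0, ω_i, θ_{0i}, θ_{ij}` are `a₀, a i, b i, t i j`, the functions
`I_{ijk}` are `I i j k`, and `E, e i, f i` are dual to `a₀, a i, b i` and annihilated
by `t i j`. -/
structure FlatStructure (U : Set H) (a₀ : H → H →L[ℝ] ℝ) (a b : Fin n → H → H →L[ℝ] ℝ)
    (t : Fin n → Fin n → H → H →L[ℝ] ℝ) (I : Fin n → Fin n → Fin n → H → ℝ)
    (E : H → H) (e f : Fin n → H → H) : Prop where
  isOpen : IsOpen U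
  smooth_a₀ : ContDiffOn ℝ ∞ a₀ U
  smooth_a : ∀ i, ContDiffOn ℝ ∞ (a i) U
  smooth_b : ∀ i, ContDiffOn ℝ ∞ (b i) U
  smooth_t : ∀ i j, ContDiffOn ℝ ∞ (t i j) U
  smooth_I : ∀ i j k, ContDiffOn ℝ ∞ (I i j k) U
  smooth_E : ContDiffOn ℝ ∞ E U
  smooth_e : ∀ i, ContDiffOn ℝ ∞ (e i) U
  smooth_f : ∀ i, ContDiffOn ℝ ∞ (f i) U
  a₀_E : ∀ y ∈ U, a₀ y (E y) = 1
  a_E : ∀ y ∈ U, ∀ i, a i y (E y) = 0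
  b_E : ∀ y ∈ U, ∀ i, b i y (E y) = 0
  t_E : ∀ y ∈ U, ∀ i j, t i j y (E y) = 0
  a₀_e : ∀ y ∈ U, ∀ j, a₀ y (e j y) = 0
  a_e : ∀ y ∈ U, ∀ i j, a i y (e j y) = if i = j then 1 else 0
  b_e : ∀ y ∈ U, ∀ i j, b i y (e j y) = 0
  t_e : ∀ y ∈ U, ∀ i k j, t i k y (e j y) = 0
  a₀_f : ∀ y ∈ U, ∀ j, a₀ y (f j y) = 0
  a_f : ∀ y ∈ U, ∀ i j, a i y (f j y) = 0
  b_f : ∀ y ∈ U, ∀ i j, b i y (f j y) = if i = j then 1 else 0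
  t_f : ∀ y ∈ U, ∀ i k j, t i k y (f j y) = 0
  skew : ∀ y ∈ U, ∀ i j, t i j y = -t j i y
  symm : ∀ y ∈ U, ∀ i j k, I i j k y = I j i k y
  d_a₀ : ∀ y ∈ U, ∀ v w, flatD a₀ y v w = -∑ j, wedge (b j y) (a j y) v w
  d_a : ∀ y ∈ U, ∀ i v w, flatD (a i) y v w =
    wedge (b i y) (a₀ y) v w - ∑ j, wedge (t i j y) (a j y) v w
      - ∑ j, ∑ k, I i j k y * wedge (b k y) (a j y) v w

namespace FlatStructure

variable {U : Set H} {a₀ : H → H →L[ℝ] ℝ} {a b : Fin n → H → H →L[ℝ] ℝ}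
    {t : Fin n → Fin n → H → H →L[ℝ] ℝ} {I : Fin n → Fin n → Fin n → H → ℝ}
    {E : H → H} {e f : Fin n → H → H} (h : FlatStructure U a₀ a b t I E e f)
include h

lemma diff {F : Type*} [NormedAddCommGroup F] [NormedSpace ℝ F] {g : H → F}
    (hg : ContDiffOn ℝ ∞ g U) {y : H} (hy : y ∈ U) : DifferentiableAt ℝ g y :=
  (hg.contDiffAt (h.isOpen.mem_nhds hy)).differentiableAt (by simp)

/-- `d² ω_0 = 0`. -/
lemma bianchi_zero {y : H} (hy : y ∈ U) (u v w : H) :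
    ∑ j, flatDWedge (b j) (a j) y u v w = 0 := by
  have hU := h.isOpen.mem_nhds hy
  have key : ∀ u v w : H, fderiv ℝ (fun z => flatD a₀ z v w) y u =
      -∑ j, fderiv ℝ (fun z => wedge (b j z) (a j z) v w) y u := by
    intro u v w
    have : (fun z => flatD a₀ z v w) =ᶠ[nhds y] fun z => -∑ j, wedge (b j z) (a j z) v w :=
      Filter.eventually_of_mem hU fun z hz => h.d_a₀ z hz v w
    rw [this.fderiv_eq, fderiv_fun_neg, fderiv_fun_sum fun j _ =>
      differentiableAt_wedge (h.diff (h.smooth_b j) hy) (h.diff (h.smooth_a j) hy) v w]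
    simp
  have h0 := flatD_closed (h.smooth_a₀.contDiffAt hU) u v w
  rw [key, key, key, ← neg_add, ← neg_add, ← Finset.sum_add_distrib, ← Finset.sum_add_distrib,
    neg_eq_zero] at h0
  rw [← h0]
  exact Finset.sum_congr rfl fun j _ => (cyclic_fderiv_wedge (h.diff (h.smooth_b j) hy)
    (h.diff (h.smooth_a j) hy) u v w).symm

/-- `d² ω_i = 0`. -/
lemma bianchi_one {y : H} (hy : y ∈ U) (i : Fin n) (u v w : H) :
    flatDWedge (b i) a₀ y u v w - ∑ j, flatDWedge (t i j) (a j) y u v w -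
      ∑ j, ∑ k, (I i j k y * flatDWedge (b k) (a j) y u v w +
        (fderiv ℝ (I i j k) y u * wedge (b k y) (a j y) v w +
          fderiv ℝ (I i j k) y v * wedge (b k y) (a j y) w u +
          fderiv ℝ (I i j k) y w * wedge (b k y) (a j y) u v)) = 0 := by
  have hU := h.isOpen.mem_nhds hy
  have da := fun i => h.diff (h.smooth_a i) hy
  have db := fun i => h.diff (h.smooth_b i) hy
  have dt := fun i j => h.diff (h.smooth_t i j) hy
  have dI := fun i j k => h.diff (h.smooth_I i j k) hy
  have da₀ := h.diff h.smooth_a₀ hy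
  have key : ∀ u v w : H, fderiv ℝ (fun z => flatD (a i) z v w) y u =
      fderiv ℝ (fun z => wedge (b i z) (a₀ z) v w) y u -
        ∑ j, fderiv ℝ (fun z => wedge (t i j z) (a j z) v w) y u -
        ∑ j, ∑ k, (I i j k y * fderiv ℝ (fun z => wedge (b k z) (a j z) v w) y u +
          fderiv ℝ (I i j k) y u * wedge (b k y) (a j y) v w) := by
    intro u v w
    have : (fun z => flatD (a i) z v w) =ᶠ[nhds y] fun z => wedge (b i z) (a₀ z) v w -
        ∑ j, wedge (t i j z) (a j z) v w - ∑ j, ∑ k, I i j k z * wedge (b k z) (a j z) v w :=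
      Filter.eventually_of_mem hU fun z hz => h.d_a z hz i v w
    have hw : ∀ j k, HasFDerivAt (fun z => I i j k z * wedge (b k z) (a j z) v w) _ y := fun j k =>
      (dI i j k).hasFDerivAt.fun_mul (differentiableAt_wedge (db k) (da j) v w).hasFDerivAt
    rw [this.fderiv_eq, (((differentiableAt_wedge (db i) da₀ v w).hasFDerivAt.fun_sub
      (HasFDerivAt.fun_sum fun j _ =>
        (differentiableAt_wedge (dt i j) (da j) v w).hasFDerivAt)).fun_sub
      (HasFDerivAt.fun_sum fun j _ => HasFDerivAt.fun_sum fun k _ => hw j k)).fderiv]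
    simp [mul_comm]
  have h0 := flatD_closed ((h.smooth_a i).contDiffAt hU) u v w
  rw [key, key, key] at h0
  simp only [← cyclic_fderiv_wedge (db _) (da _), ← cyclic_fderiv_wedge (db _) da₀,
    ← cyclic_fderiv_wedge (dt _ _) (da _)]
  rw [← h0]
  simp only [mul_add, Finset.sum_add_distrib]
  ring

lemma d_a_ker {y : H} (hy : y ∈ U) (i : Fin n) {X Y : H} (hX : ∀ j, a j y X = 0)
    (hY : ∀ j, a j y Y = 0) :
    flatD (a i) y X Y = b i y X * a₀ y Y - b i y Y * a₀ y X := by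
  simp [h.d_a y hy, wedge, hX, hY]

lemma d_a_e {y : H} (hy : y ∈ U) (i m : Fin n) {X : H} (hX : ∀ j, a j y X = 0) :
    flatD (a i) y X (e m y) = -t i m y X - ∑ k, I i m k y * b k y X := by
  simp [h.d_a y hy, wedge, hX, h.a_e y hy, h.a₀_e y hy, h.b_e y hy, h.t_e y hy]

lemma d_a_e' {y : H} (hy : y ∈ U) (i m : Fin n) {X : H} (hX : ∀ j, a j y X = 0) :
    flatD (a i) y (e m y) X = t i m y X + ∑ k, I i m k y * b k y X := by
  rw [flatD_swap, h.d_a_e hy i m hX]; ring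

lemma d_a_ee {y : H} (hy : y ∈ U) (i l m : Fin n) : flatD (a i) y (e l y) (e m y) = 0 := by
  simp [h.d_a y hy, wedge, h.a₀_e y hy, h.b_e y hy, h.t_e y hy]

/-- `dθ_{0i}` on two vectors annihilated by all `ω_j`. -/
lemma d_b_ker {y : H} (hy : y ∈ U) (i : Fin n) {X Y : H} (hX : ∀ j, a j y X = 0)
    (hY : ∀ j, a j y Y = 0) :
    flatD (b i) y X Y = ∑ j, (b j y Y * (t j i y X + ∑ k, I j i k y * b k y X) -
      b j y X * (t j i y Y + ∑ k, I j i k y * b k y Y)) := by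
  have := h.bianchi_zero hy X Y (e i y)
  simp only [flatDWedge, h.d_a_e hy _ _ hY, h.d_a_e' hy _ _ hX, h.a_e y hy, h.b_e y hy, hX, hY] at this
  simp only [Finset.sum_add_distrib, mul_ite, Finset.sum_sub_distrib, mul_one, mul_zero,
    Finset.sum_ite_eq', Finset.mem_univ, if_true, zero_mul, sub_zero, add_zero] at this ⊢
  simp only [Finset.sum_sub_distrib, mul_add, mul_sub, mul_neg, Finset.sum_add_distrib,
    Finset.sum_neg_distrib, Finset.sum_const_zero] at this ⊢
  linarith

lemma d_b_E_f {y : H} (hy : y ∈ U) (i k : Fin n) : flatD (b i) y (E y) (f k y) = 0 := by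
  simp [h.d_b_ker hy i (h.a_E y hy) (h.a_f y hy · k), h.b_E y hy, h.t_E y hy]

/-- `I_{ijk}` is symmetric in `j, k`. -/
lemma symm_right {y : H} (hy : y ∈ U) (i j k : Fin n) : I i j k y = I i k j y := by
  have h1 := h.bianchi_one hy i (E y) (f j y) (f k y)
  have haf := fun k j => h.a_f y hy j k
  have h2 := h.d_b_ker hy i (haf j) (haf k)
  simp [h.b_f y hy, h.t_f y hy] at h2
  simp [flatDWedge, wedge, h.d_a_ker hy _ (haf _) (haf _), h.d_a_ker hy _ (h.a_E y hy) (haf _),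
    h.d_a_ker hy _ (haf _) (h.a_E y hy), h.a_f y hy, h.a_E y hy, h.a₀_E y hy, h.a₀_f y hy,
    h.b_E y hy, h.b_f y hy, h.t_E y hy, h.t_f y hy, h.d_a₀ y hy] at h1
  rw [h2] at h1
  have h3 := h.symm y hy j i k
  have h4 := h.symm y hy k i j
  simp [mul_add, Finset.sum_add_distrib, Finset.sum_ite_irrel] at h1
  linarith

lemma d_b_ff {y : H} (hy : y ∈ U) (i j k : Fin n) : flatD (b i) y (f j y) (f k y) = 0 := by
  have haf := fun k j => h.a_f y hy j k
  have h2 := h.d_b_ker hy i (haf j) (haf k)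
  simp [h.b_f y hy, h.t_f y hy] at h2
  rw [h2, h.symm y hy k, h.symm_right hy i k, h.symm y hy i, sub_self]

/-- `R_{0i0j}` is symmetric. -/
lemma curv_symm {y : H} (hy : y ∈ U) (i j : Fin n) :
    flatD (b i) y (E y) (e j y) = flatD (b j) y (E y) (e i y) := by
  have h1 := h.bianchi_zero hy (E y) (e i y) (e j y)
  simp [flatDWedge, h.a_E y hy, h.a_e y hy, h.b_E y hy, h.b_e y hy,
    Finset.sum_add_distrib] at h1
  rw [flatD_swap (b i) y (e j y)] at h1
  linarith

/-- `J_{ijk}` is symmetric in `i, j`. -/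
lemma J_symm {y : H} (hy : y ∈ U) (i j k : Fin n) :
    flatD (b i) y (f k y) (e j y) = flatD (b j) y (f k y) (e i y) := by
  have h1 := h.bianchi_zero hy (f k y) (e i y) (e j y)
  simp [flatDWedge, h.a_f y hy, h.a_e y hy, h.b_f y hy, h.b_e y hy,
    Finset.sum_add_distrib, h.d_a_ee hy] at h1
  rw [flatD_swap (b i) y (e j y)] at h1
  linarith

section Vertical

variable {y A : H} (hA : ∀ j, a j y A = 0) (hA' : ∀ j, b j y A = 0) (hA₀ : a₀ y A = 0)
include hA hA'

/-! Here `A` is annihilated by all `ω_j` and `θ_{0j}`, and, where `hA₀` is assumed, by `ω_0`. -/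

lemma d_b_E_vert (hy : y ∈ U) (i : Fin n) : flatD (b i) y (E y) A = 0 := by
  simp [h.d_b_ker hy i (h.a_E y hy) hA, h.b_E y hy, h.t_E y hy, hA']

lemma d_b_vert_f (hy : y ∈ U) (i k : Fin n) : flatD (b i) y A (f k y) = t k i y A := by
  simp [h.d_b_ker hy i hA (h.a_f y hy · k), h.b_f y hy, h.t_f y hy, hA']

lemma d_b_vert_e_symm (hy : y ∈ U) (i j : Fin n) :
    flatD (b i) y A (e j y) = flatD (b j) y A (e i y) := by
  have h1 := h.bianchi_zero hy A (e i y) (e j y)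
  simp [flatDWedge, h.a_e y hy, h.b_e y hy, hA, hA', h.d_a_ee hy,
    Finset.sum_add_distrib] at h1
  rw [flatD_swap (b i) y (e j y)] at h1
  linarith

include hA₀

/-- The equation `d² ω_i = 0` on `E, A, e_j`. The left side is symmetric in `i, j` and the right
side is skew, so that both vanish. -/
lemma d_t_E_vert_aux (hy : y ∈ U) (i j : Fin n) :
    flatD (b i) y A (e j y) = flatD (t i j) y (E y) A := by
  have h1 := h.bianchi_one hy i (E y) A (e j y)
  simp [flatDWedge, wedge, h.a_E y hy, h.a_e y hy, h.a₀_E y hy, h.a₀_e y hy, hA₀,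
    h.b_E y hy, h.b_e y hy, h.t_E y hy, h.t_e y hy, h.d_a₀ y hy, hA, hA',
    h.d_b_E_vert hA hA' hy, h.d_a_e' hy _ _ (h.a_E y hy)] at h1
  linarith

end Vertical

lemma d_t_skew {y : H} (hy : y ∈ U) (i j : Fin n) (v w : H) :
    flatD (t i j) y v w = -flatD (t j i) y v w := by
  have : t i j =ᶠ[nhds y] fun z => -t j i z :=
    Filter.eventually_of_mem (h.isOpen.mem_nhds hy) fun z hz => h.skew z hz i j
  simp [flatD, this.fderiv_eq, fderiv_fun_neg]
  ring

lemma d_b_vert_e {y A : H} (hA : ∀ j, a j y A = 0) (hA' : ∀ j, b j y A = 0) (hA₀ : a₀ y A = 0)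
    (hy : y ∈ U) (i j : Fin n) : flatD (b i) y A (e j y) = 0 := by
  have h1 := h.d_t_E_vert_aux hA hA' hA₀ hy i j
  have h2 := h.d_t_E_vert_aux hA hA' hA₀ hy j i
  have h3 := h.d_b_vert_e_symm hA hA' hy i j
  have h4 := h.d_t_skew hy i j (E y) A
  linarith

lemma d_t_E_vert {y A : H} (hA : ∀ j, a j y A = 0) (hA' : ∀ j, b j y A = 0) (hA₀ : a₀ y A = 0)
    (hy : y ∈ U) (i j : Fin n) : flatD (t i j) y (E y) A = 0 := by
  rw [← h.d_t_E_vert_aux hA hA' hA₀ hy, h.d_b_vert_e hA hA' hA₀ hy]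

/-- The equation `d² ω_i = 0` on `E, f_k, e_j`. -/
lemma J_eq_aux {y : H} (hy : y ∈ U) (i j k : Fin n) :
    flatD (b i) y (f k y) (e j y) =
      flatD (t i j) y (E y) (f k y) + fderiv ℝ (I i j k) y (E y) := by
  have h1 := h.bianchi_one hy i (E y) (f k y) (e j y)
  simp [flatDWedge, wedge, h.a_E y hy, h.a_e y hy, h.a₀_E y hy, h.a₀_e y hy,
    h.b_E y hy, h.b_e y hy, h.t_E y hy, h.t_e y hy, h.d_a₀ y hy, h.a₀_f y hy, h.a_f y hy,
    h.b_f y hy, h.t_f y hy, h.d_b_E_f hy, h.d_a_e' hy _ _ (h.a_E y hy)] at h1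
  linarith

/-- By `J_eq_aux`, this quantity, which is skew in `i, j`, is the difference of two quantities
that are symmetric in `i, j`. -/
lemma d_t_E_f {y : H} (hy : y ∈ U) (i j k : Fin n) : flatD (t i j) y (E y) (f k y) = 0 := by
  have h1 := h.J_eq_aux hy i j k
  have h2 := h.J_eq_aux hy j i k
  have h3 := h.J_symm hy i j k
  have h4 := h.d_t_skew hy i j (E y) (f k y)
  have h5 : I i j k =ᶠ[nhds y] I j i k :=
    Filter.eventually_of_mem (h.isOpen.mem_nhds hy) fun z hz => h.symm z hz i j k
  rw [h5.fderiv_eq] at h1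
  linarith

/-- `E (I_{ijk}) = J_{ijk}`. -/
lemma fderiv_I_E {y : H} (hy : y ∈ U) (i j k : Fin n) :
    fderiv ℝ (I i j k) y (E y) = flatD (b i) y (f k y) (e j y) := by
  rw [h.J_eq_aux hy, h.d_t_E_f hy, zero_add]

/-- `J_{ijk}` is symmetric in `j, k`. -/
lemma J_symm_right {y : H} (hy : y ∈ U) (i j k : Fin n) :
    flatD (b i) y (f k y) (e j y) = flatD (b i) y (f j y) (e k y) := by
  have h5 : I i j k =ᶠ[nhds y] I i k j :=
    Filter.eventually_of_mem (h.isOpen.mem_nhds hy) fun z hz => h.symm_right hz i j k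
  rw [← h.fderiv_I_E hy, ← h.fderiv_I_E hy, h5.fderiv_eq]

/-- Expansion of `i_E dα` in the coframing `ω_0, ω_i, θ_{0i}`, for a form `α` such that
`dα (E, A) = 0` whenever `ω_0, ω_i, θ_{0i}` annihilate `A`. -/
lemma flatD_E_eq {y : H} (hy : y ∈ U) (α : H → H →L[ℝ] ℝ)
    (hα : ∀ A, (∀ j, a j y A = 0) → (∀ j, b j y A = 0) → a₀ y A = 0 → flatD α y (E y) A = 0)
    (v : H) : flatD α y (E y) v = ∑ j, a j y v * flatD α y (E y) (e j y) +
      ∑ j, b j y v * flatD α y (E y) (f j y) := by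
  obtain ⟨A, hA⟩ : ∃ A, A = v - a₀ y v • E y - ∑ j, a j y v • e j y - ∑ j, b j y v • f j y :=
    ⟨_, rfl⟩
  have hv : v = a₀ y v • E y + ∑ j, a j y v • e j y + ∑ j, b j y v • f j y + A := by
    rw [hA]; abel
  have hA0 : flatD α y (E y) A = 0 := hα A
    (fun j => by simp [hA, h.a_E y hy, h.a_e y hy, h.a_f y hy])
    (fun j => by simp [hA, h.b_E y hy, h.b_e y hy, h.b_f y hy])
    (by simp [hA, h.a₀_E y hy, h.a₀_e y hy, h.a₀_f y hy])
  rw [flatD_swap] at hA0 ⊢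
  conv_lhs => rw [hv]
  have hE : flatD α y (E y) (E y) = 0 := sub_self _
  simp only [flatD_add_left, flatD_smul_left, flatD_sum_left, hE,
    fun j => flatD_swap α y (e j y) (E y), fun j => flatD_swap α y (f j y) (E y),
    mul_neg, Finset.sum_neg_distrib]
  linarith

section ConstantCurvature

variable {c : ℝ} (hc : ∀ y ∈ U, ∀ i j, flatD (b i) y (E y) (e j y) = if i = j then c else 0)
include hc

/-- `d² ω_i = 0` on `E, e_j, e_k` expresses `R_{0ijk}` by the components of `dθ_{ij}`. -/
lemma curv_eq {y : H} (hy : y ∈ U) (i j k : Fin n) : flatD (b i) y (e j y) (e k y) =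
    flatD (t i k) y (E y) (e j y) - flatD (t i j) y (E y) (e k y) := by
  have h1 := h.bianchi_one hy i (E y) (e j y) (e k y)
  have hs : ∀ i j, flatD (b i) y (e j y) (E y) = -if i = j then c else 0 := fun i j => by
    rw [flatD_swap, hc y hy]
  have hs' : ∀ i j k, flatD (t i j) y (e k y) (E y) = -flatD (t i j) y (E y) (e k y) :=
    fun i j k => flatD_swap _ _ _ _
  simp [flatDWedge, wedge, h.a_E y hy, h.a_e y hy, h.a₀_E y hy, h.a₀_e y hy,
    h.b_E y hy, h.b_e y hy, h.t_E y hy, h.t_e y hy, h.d_a₀ y hy, hc y hy,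
    h.d_a_e' hy _ _ (h.a_E y hy), h.d_a_e hy _ _ (h.a_E y hy), h.d_a_ee hy,
    Finset.sum_add_distrib, hs, hs', mul_add] at h1
  rw [h.symm_right hy i k j] at h1
  linarith

/-- `i_E dθ_{0i} = c ω_i`. -/
lemma d_b_E {y : H} (hy : y ∈ U) (i : Fin n) (v : H) : flatD (b i) y (E y) v = c * a i y v := by
  rw [h.flatD_E_eq hy _ fun A hA hA' _ => h.d_b_E_vert hA hA' hy i]
  simp [hc y hy, h.d_b_E_f hy, mul_comm]

omit h hc in
lemma fderiv_eq_zero_of_eqOn_const {U : Set H} (hU : IsOpen U) {g : H → ℝ} {r : ℝ}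
    (hg : ∀ z ∈ U, g z = r) {y : H} (hy : y ∈ U) : fderiv ℝ g y = 0 := by
  have : g =ᶠ[nhds y] fun _ => r := Filter.eventually_of_mem (hU.mem_nhds hy) hg
  rw [this.fderiv_eq]
  simp

omit hc in
/-- Cartan's formula for a form whose values on the fields `V` and `W` are constant. -/
lemma apply_lieBracket_of_const {α : H → H →L[ℝ] ℝ} (hα : ContDiffOn ℝ ∞ α U) {V W : H → H}
    (hV : ContDiffOn ℝ ∞ V U) (hW : ContDiffOn ℝ ∞ W U) {r s : ℝ} (hr : ∀ z ∈ U, α z (V z) = r)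
    (hs : ∀ z ∈ U, α z (W z) = s) {y : H} (hy : y ∈ U) :
    α y (VectorField.lieBracket ℝ V W y) = -flatD α y (V y) (W y) := by
  rw [apply_lieBracket (h.diff hα hy) (h.diff hV hy) (h.diff hW hy),
    fderiv_eq_zero_of_eqOn_const h.isOpen hr hy, fderiv_eq_zero_of_eqOn_const h.isOpen hs hy]
  simp

omit hc in
/-- The bracket `[E, f_k]` is `e_k` up to a vector annihilated by `ω_0, ω_i, θ_{0i}`. -/
lemma d_b_lieBracket_E_f {y : H} (hy : y ∈ U) (i j k : Fin n) :
    flatD (b i) y (VectorField.lieBracket ℝ E (f k) y) (e j y) =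
      flatD (b i) y (e k y) (e j y) := by
  have h0 : a₀ y (VectorField.lieBracket ℝ E (f k) y) = 0 := by
    rw [h.apply_lieBracket_of_const h.smooth_a₀ h.smooth_E (h.smooth_f k) h.a₀_E
      (fun z hz => h.a₀_f z hz k) hy]
    simp [h.d_a₀ y hy, wedge, h.a_E y hy, h.b_E y hy]
  have ha : ∀ m, a m y (VectorField.lieBracket ℝ E (f k) y) = if m = k then 1 else 0 := fun m => by
    rw [h.apply_lieBracket_of_const (h.smooth_a m) h.smooth_E (h.smooth_f k)
      (fun z hz => h.a_E z hz m) (fun z hz => h.a_f z hz m k) hy,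
      h.d_a_ker hy m (h.a_E y hy) (fun l => h.a_f y hy l k)]
    simp [h.b_E y hy, h.a₀_E y hy, h.b_f y hy]
  have hb : ∀ m, b m y (VectorField.lieBracket ℝ E (f k) y) = 0 := fun m => by
    rw [h.apply_lieBracket_of_const (h.smooth_b m) h.smooth_E (h.smooth_f k)
      (fun z hz => h.b_E z hz m) (fun z hz => h.b_f z hz m k) hy, h.d_b_E_f hy, neg_zero]
  -- `[E, f_k] - e_k` is annihilated by `ω_0`, all `ω_j` and all `θ_{0j}`.
  have := h.d_b_vert_e (A := VectorField.lieBracket ℝ E (f k) y - e k y)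
    (fun m => by simp [ha, h.a_e y hy]) (fun m => by simp [hb, h.b_e y hy])
    (by simp [h0, h.a₀_e y hy]) hy i j
  rw [sub_eq_add_neg, flatD_add_left, ← neg_one_smul ℝ, flatD_smul_left] at this
  linarith

/-- The bracket `[e_j, E]` is `c f_j` up to a vector annihilated by `ω_0, ω_i, θ_{0i}`. -/
lemma d_b_lieBracket_e_E {y : H} (hy : y ∈ U) (i j k : Fin n) :
    flatD (b i) y (VectorField.lieBracket ℝ (e j) E y) (f k y) =
      flatD (t k i) y (E y) (e j y) := by
  have ha : ∀ m, a m y (VectorField.lieBracket ℝ (e j) E y) = 0 := fun m => by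
    rw [h.apply_lieBracket_of_const (h.smooth_a m) (h.smooth_e j) h.smooth_E
      (fun z hz => h.a_e z hz m j) (fun z hz => h.a_E z hz m) hy,
      h.d_a_e' hy m j (h.a_E y hy)]
    simp [h.b_E y hy, h.t_E y hy]
  have hb : ∀ m, b m y (VectorField.lieBracket ℝ (e j) E y) = if m = j then c else 0 := fun m => by
    rw [h.apply_lieBracket_of_const (h.smooth_b m) (h.smooth_e j) h.smooth_E
      (fun z hz => h.b_e z hz m j) (fun z hz => h.b_E z hz m) hy, flatD_swap, hc y hy, neg_neg]
  have ht : t k i y (VectorField.lieBracket ℝ (e j) E y) = flatD (t k i) y (E y) (e j y) := by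
    rw [h.apply_lieBracket_of_const (h.smooth_t k i) (h.smooth_e j) h.smooth_E
      (fun z hz => h.t_e z hz k i j) (fun z hz => h.t_E z hz k i) hy, flatD_swap, neg_neg]
  -- `[e_j, E] - c f_j` is annihilated by all `ω_j` and `θ_{0j}`, and `dθ_{0i} (f_j, f_k) = 0`.
  have := h.d_b_vert_f (A := VectorField.lieBracket ℝ (e j) E y - c • f j y)
    (fun m => by simp [ha, h.a_f y hy]) (fun m => by simp [hb, h.b_f y hy]) hy i k
  rw [sub_eq_add_neg, flatD_add_left, ← neg_smul, flatD_smul_left, h.d_b_ff hy] at this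
  simpa [h.t_f y hy, ht] using this

/-- `d² θ_{0i} = 0` on `E, f_k, e_j`. -/
lemma fderiv_J_E_aux {y : H} (hy : y ∈ U) (i j k : Fin n) :
    fderiv ℝ (fun z => flatD (b i) z (f k z) (e j z)) y (E y) =
      flatD (b i) y (e k y) (e j y) + flatD (t k i) y (E y) (e j y) - c * I i j k y := by
  have h1 := flatD_closed_fields ((h.smooth_b i).contDiffAt (h.isOpen.mem_nhds hy))
    (h.diff h.smooth_E hy) (h.diff (h.smooth_f k) hy) (h.diff (h.smooth_e j) hy)
  have hfe : a i y (VectorField.lieBracket ℝ (f k) (e j) y) = I i j k y := by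
    rw [h.apply_lieBracket_of_const (h.smooth_a i) (h.smooth_f k) (h.smooth_e j)
      (fun z hz => h.a_f z hz i k) (fun z hz => h.a_e z hz i j) hy,
      h.d_a_e hy i j fun m => h.a_f y hy m k]
    simp [h.t_f y hy, h.b_f y hy]
  rw [fderiv_eq_zero_of_eqOn_const h.isOpen (g := fun z => flatD (b i) z (e j z) (E z))
      (r := -if i = j then c else 0)
      (fun z hz => by rw [flatD_swap, hc z hz]) hy,
    fderiv_eq_zero_of_eqOn_const h.isOpen (g := fun z => flatD (b i) z (E z) (f k z)) (r := 0)
      (fun z hz => h.d_b_E_f hz i k) hy,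
    h.d_b_lieBracket_E_f hy, h.d_b_lieBracket_e_E hc hy,
    flatD_swap (b i) y _ (E y), h.d_b_E hc hy, hfe] at h1
  simp at h1
  linarith

/-- `T_{ijk} = dθ_{ij} (E, e_k)` is skew in `i, j`, and `T_{ijk} + 2 T_{kij}` is symmetric
in `i, j, k`, being `E (J_{ijk}) + c I_{ijk}`; this forces `T = 0`. -/
lemma d_t_E_e {y : H} (hy : y ∈ U) (i j k : Fin n) : flatD (t i j) y (E y) (e k y) = 0 := by
  set T := fun i j k => flatD (t i j) y (E y) (e k y) with hT
  set K := fun i j k => fderiv ℝ (fun z => flatD (b i) z (f k z) (e j z)) y (E y) + c * I i j k y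
    with hK
  have hskew : ∀ i j k, T i j k = -T j i k := fun i j k => h.d_t_skew hy i j _ _
  have hKT : ∀ i j k, K i j k = T i j k + 2 * T k i j := fun i j k => by
    have h1 := h.fderiv_J_E_aux hc hy i j k
    have h2 := h.curv_eq hc hy i k j
    have h3 := hskew i k j
    simp only [hK, hT] at h3 ⊢
    linarith
  have hU := h.isOpen.mem_nhds hy
  have hK1 : ∀ i j k, K i j k = K j i k := fun i j k => by
    have : (fun z => flatD (b i) z (f k z) (e j z)) =ᶠ[nhds y]
        fun z => flatD (b j) z (f k z) (e i z) :=
      Filter.eventually_of_mem hU fun z hz => h.J_symm hz i j k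
    simp only [hK, this.fderiv_eq, h.symm y hy i j k]
  have hK2 : ∀ i j k, K i j k = K i k j := fun i j k => by
    have : (fun z => flatD (b i) z (f k z) (e j z)) =ᶠ[nhds y]
        fun z => flatD (b i) z (f j z) (e k z) :=
      Filter.eventually_of_mem hU fun z hz => h.J_symm_right hz i j k
    simp only [hK, this.fderiv_eq, h.symm_right hy i j k]
  change T i j k = 0
  -- With `x = T i j k`, `y = T j k i`, `z = T k i j`, the symmetry of `K` reads
  -- `x + 2 z = y + 2 x = z + 2 y = -(x + 2 y)`, whose only solution is `x = y = z = 0`.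
  have := hKT i j k
  have := hKT j k i
  have := hKT k i j
  have := hKT j i k
  have := hKT k j i
  have := hKT i k j
  have := hK1 i j k
  have := hK1 j k i
  have := hK1 k i j
  have := hK2 i j k
  have := hK2 j k i
  have := hK2 k i j
  have := hskew i j k
  have := hskew j k i
  have := hskew k i j
  linarith

/-- `R_{0ijk} = 0`. -/
lemma curv_eq_zero {y : H} (hy : y ∈ U) (i j k : Fin n) :
    flatD (b i) y (e j y) (e k y) = 0 := by
  rw [h.curv_eq hc hy, h.d_t_E_e hc hy, h.d_t_E_e hc hy, sub_zero]

/-- `E (J_{ijk}) = -c I_{ijk}`. -/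
lemma fderiv_J_E {y : H} (hy : y ∈ U) (i j k : Fin n) :
    fderiv ℝ (fun z => flatD (b i) z (f k z) (e j z)) y (E y) = -c * I i j k y := by
  rw [h.fderiv_J_E_aux hc hy, h.curv_eq_zero hc hy, h.d_t_E_e hc hy]
  ring

/-- `i_E dθ_{ij} = 0`. -/
lemma d_t_E {y : H} (hy : y ∈ U) (i j : Fin n) (v : H) : flatD (t i j) y (E y) v = 0 := by
  rw [h.flatD_E_eq hy _ fun A hA hA' hA₀ => h.d_t_E_vert hA hA' hA₀ hy i j]
  simp [h.d_t_E_e hc hy, h.d_t_E_f hy]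

end ConstantCurvature

/-- `i_E dω_i = -θ_{0i}`. -/
lemma d_a_E {y : H} (hy : y ∈ U) (i : Fin n) (v : H) : flatD (a i) y (E y) v = -b i y v := by
  simp [h.d_a y hy, wedge, h.a_E y hy, h.b_E y hy, h.t_E y hy, h.a₀_E y hy]

end FlatStructure

end Structure

/-! ### Forms and fields in charts -/

section Charts

variable {H : Type*} [NormedAddCommGroup H] [NormedSpace ℝ H]
variable {X : Type*} [TopologicalSpace X] [ChartedSpace H X] [IsManifold 𝓘(ℝ, H) ∞ X]

lemma mfderiv_chart_symm_apply {p x : X} (hx : x ∈ (extChartAt 𝓘(ℝ, H) p).source)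
    (v : TangentSpace 𝓘(ℝ, H) x) :
    mfderiv 𝓘(ℝ, H) 𝓘(ℝ, H) (extChartAt 𝓘(ℝ, H) p).symm (extChartAt 𝓘(ℝ, H) p x)
      (mfderiv 𝓘(ℝ, H) 𝓘(ℝ, H) (extChartAt 𝓘(ℝ, H) p) x v) = v := by
  have : IsManifold 𝓘(ℝ, H) 1 X := .of_le (n := ∞) (by simp)
  have := mfderivWithin_extChartAt_symm_comp_mfderiv_extChartAt' hx
  simp only [modelWithCornersSelf_coe, Set.range_id, mfderivWithin_univ] at this
  exact DFunLike.congr_fun this v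

lemma mdifferentiableAt_chart_symm {p : X} {y : H} (hy : y ∈ (extChartAt 𝓘(ℝ, H) p).target) :
    MDifferentiableAt 𝓘(ℝ, H) 𝓘(ℝ, H) (extChartAt 𝓘(ℝ, H) p).symm y :=
  ((contMDiffOn_extChartAt_symm p).contMDiffAt
    ((isOpen_extChartAt_target p).mem_nhds hy)).mdifferentiableAt (n := ∞) (by simp)

lemma mdifferentiableAt_chart {p x : X} (hx : x ∈ (extChartAt 𝓘(ℝ, H) p).source) :
    MDifferentiableAt 𝓘(ℝ, H) 𝓘(ℝ, H) (extChartAt 𝓘(ℝ, H) p) x :=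
  (contMDiffAt_extChartAt' (n := ∞) (by simpa using hx)).mdifferentiableAt (by simp)

lemma mfderiv_chart_symm_chart {p : X} {y : H} (hy : y ∈ (extChartAt 𝓘(ℝ, H) p).target)
    (v : TangentSpace 𝓘(ℝ, H) ((extChartAt 𝓘(ℝ, H) p).symm y)) :
    mfderiv 𝓘(ℝ, H) 𝓘(ℝ, H) (extChartAt 𝓘(ℝ, H) p).symm y
      (mfderiv 𝓘(ℝ, H) 𝓘(ℝ, H) (extChartAt 𝓘(ℝ, H) p) ((extChartAt 𝓘(ℝ, H) p).symm y) v) = v := by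
  have : IsManifold 𝓘(ℝ, H) 1 X := .of_le (n := ∞) (by simp)
  have := mfderivWithin_extChartAt_symm_comp_mfderiv_extChartAt hy
  simp only [modelWithCornersSelf_coe, Set.range_id, mfderivWithin_univ] at this
  exact DFunLike.congr_fun this v

lemma mfderiv_chart_chart_symm {p : X} {y : H} (hy : y ∈ (extChartAt 𝓘(ℝ, H) p).target) (v : H) :
    mfderiv 𝓘(ℝ, H) 𝓘(ℝ, H) (extChartAt 𝓘(ℝ, H) p) ((extChartAt 𝓘(ℝ, H) p).symm y)
      (mfderiv 𝓘(ℝ, H) 𝓘(ℝ, H) (extChartAt 𝓘(ℝ, H) p).symm y v) = v := by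
  have : IsManifold 𝓘(ℝ, H) 1 X := .of_le (n := ∞) (by simp)
  have := mfderiv_extChartAt_comp_mfderivWithin_extChartAt_symm hy
  simp only [modelWithCornersSelf_coe, Set.range_id, mfderivWithin_univ] at this
  exact DFunLike.congr_fun this v

/-- Pairing a covector with a vector gives the same result in any chart. -/
lemma formInChart_apply_chart (α : OneForm H X) {p x : X}
    (hx : x ∈ (extChartAt 𝓘(ℝ, H) p).source) (v : TangentSpace 𝓘(ℝ, H) x) :
    formInChart α p (extChartAt 𝓘(ℝ, H) p x)
      (mfderiv 𝓘(ℝ, H) 𝓘(ℝ, H) (extChartAt 𝓘(ℝ, H) p) x v) = α x v := by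
  have key : ∀ x', x' = x → α x' v = α x v := by rintro _ rfl; rfl
  refine Eq.trans ?_ (key _ ((extChartAt 𝓘(ℝ, H) p).left_inv hx))
  exact congrArg (α _) (mfderiv_chart_symm_apply hx v)

lemma formInChart_apply_fieldInChart (α : OneForm H X) (Y : VField H X) {p : X} {y : H}
    (hy : y ∈ (extChartAt 𝓘(ℝ, H) p).target) :
    formInChart α p y (fieldInChart Y p y) =
      α ((extChartAt 𝓘(ℝ, H) p).symm y) (Y ((extChartAt 𝓘(ℝ, H) p).symm y)) :=
  congrArg (α _) (mfderiv_chart_symm_chart hy _)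

omit [IsManifold 𝓘(ℝ, H) ∞ X] in
/-- `dExt` is defined in the chart around the base point, where it is `flatD`. -/
lemma dExt_eq_flatD (α : OneForm H X) (p : X) (v w : TangentSpace 𝓘(ℝ, H) p) :
    dExt α p v w = flatD (formInChart α p) (extChartAt 𝓘(ℝ, H) p p)
      (mfderiv 𝓘(ℝ, H) 𝓘(ℝ, H) (extChartAt 𝓘(ℝ, H) p) p v)
      (mfderiv 𝓘(ℝ, H) 𝓘(ℝ, H) (extChartAt 𝓘(ℝ, H) p) p w) := by
  have : (fun y => ContinuousAlternatingMap.ofSubsingleton ℝ H ℝ (0 : Fin 1)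
      (formInChart α p y)) =
      ContinuousAlternatingMap.ofSubsingletonLIE (𝕜 := ℝ) (E := H) (F := ℝ) (0 : Fin 1) ∘
        formInChart α p := rfl
  rw [dExt, this, extDeriv, LinearIsometryEquiv.comp_fderiv]
  simp [ContinuousAlternatingMap.alternatizeUncurryFin_apply, flatD, Fin.sum_univ_two,
    sub_eq_add_neg, Fin.removeNth]

variable {H' : Type*} [NormedAddCommGroup H'] [NormedSpace ℝ H']
variable {B : Type*} [TopologicalSpace B] [ChartedSpace H' B] [IsManifold 𝓘(ℝ, H') ∞ B]

/-- The exterior derivative of a one-form commutes with pull-backs, and does not depend on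
the chart in which it is computed. -/
lemma dExt_pullback {b : X → B} (hb : ContMDiff 𝓘(ℝ, H) 𝓘(ℝ, H') ∞ b) {α : OneForm H X}
    {β : OneForm H' B} {x : X} {q : B} (hx : b x ∈ (extChartAt 𝓘(ℝ, H') q).source)
    (hα : ∀ᶠ z in nhds x, α z = (β (b z)).comp (mfderiv 𝓘(ℝ, H) 𝓘(ℝ, H') b z))
    (hβ : DifferentiableAt ℝ (formInChart β q) (extChartAt 𝓘(ℝ, H') q (b x)))
    (v w : TangentSpace 𝓘(ℝ, H) x) :
    dExt α x v w = flatD (formInChart β q) (extChartAt 𝓘(ℝ, H') q (b x))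
      (mfderiv 𝓘(ℝ, H') 𝓘(ℝ, H') (extChartAt 𝓘(ℝ, H') q) (b x) (mfderiv 𝓘(ℝ, H) 𝓘(ℝ, H') b x v))
      (mfderiv 𝓘(ℝ, H') 𝓘(ℝ, H') (extChartAt 𝓘(ℝ, H') q) (b x)
        (mfderiv 𝓘(ℝ, H) 𝓘(ℝ, H') b x w)) := by
  set χ := extChartAt 𝓘(ℝ, H) x with hχ
  set ψ := extChartAt 𝓘(ℝ, H') q with hψ
  -- `g` is the expression of `b` in the charts.
  set g : H → H' := fun y => ψ (b (χ.symm y)) with hg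
  have hxs : χ.symm (χ x) = x := extChartAt_to_inv x
  have hnhds : χ.target ∈ nhds (χ x) := extChartAt_target_mem_nhds x
  have hcont : Filter.Tendsto χ.symm (nhds (χ x)) (nhds x) := by
    have := (continuousOn_extChartAt_symm (I := 𝓘(ℝ, H)) x).continuousAt hnhds
    rwa [ContinuousAt, hxs] at this
  have hψx : ψ.source ∈ nhds (b x) := (isOpen_extChartAt_source q).mem_nhds hx
  have hbs : ∀ᶠ y in nhds (χ x), b (χ.symm y) ∈ ψ.source :=
    (hb.continuous.continuousAt.tendsto.comp hcont).eventually hψx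
  have hderiv : ∀ y ∈ χ.target, b (χ.symm y) ∈ ψ.source → ∀ u : H, fderiv ℝ g y u =
      mfderiv 𝓘(ℝ, H') 𝓘(ℝ, H') ψ (b (χ.symm y)) (mfderiv 𝓘(ℝ, H) 𝓘(ℝ, H') b (χ.symm y)
        (mfderiv 𝓘(ℝ, H) 𝓘(ℝ, H) χ.symm y u)) := by
    intro y hy hyb u
    have h1 := (mdifferentiableAt_chart_symm hy)
    have h2 := hb.mdifferentiableAt (x := χ.symm y) (by simp)
    have h3 := mdifferentiableAt_chart hyb
    have : fderiv ℝ g y = mfderiv 𝓘(ℝ, H) 𝓘(ℝ, H') (ψ ∘ b ∘ χ.symm) y := mfderiv_eq_fderiv.symm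
    rw [this, mfderiv_comp y h3 (h2.comp y h1), mfderiv_comp y h2 h1]
    rfl
  have hgs : ContDiffAt ℝ ∞ g (χ x) := by
    rw [← contMDiffAt_iff_contDiffAt]
    refine ContMDiffAt.comp (I' := 𝓘(ℝ, H')) (χ x) (g := ψ) (f := fun y => b (χ.symm y)) ?_ ?_
    · refine contMDiffAt_extChartAt' ?_
      rw [hxs]
      simpa [hψ] using hx
    · exact hb.contMDiffAt.comp (χ x) ((contMDiffOn_extChartAt_symm x).contMDiffAt hnhds)
  have heq : formInChart α x =ᶠ[nhds (χ x)]
      fun y => (formInChart β q (g y)).comp (fderiv ℝ g y) := by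
    filter_upwards [hnhds, hbs, hcont.eventually hα] with y hy hyb hya
    ext u
    have h1 : formInChart α x y u = β (b (χ.symm y)) (mfderiv 𝓘(ℝ, H) 𝓘(ℝ, H') b (χ.symm y)
        (mfderiv 𝓘(ℝ, H) 𝓘(ℝ, H) χ.symm y u)) :=
      DFunLike.congr_fun hya _
    rw [h1, ContinuousLinearMap.comp_apply, hderiv y hy hyb]
    exact (formInChart_apply_chart β hyb _).symm
  have hgx : g (χ x) = ψ (b x) := by simp only [hg, hxs]
  have hder : ∀ u : TangentSpace 𝓘(ℝ, H) x,
      fderiv ℝ g (χ x) (mfderiv 𝓘(ℝ, H) 𝓘(ℝ, H) χ x u) =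
        mfderiv 𝓘(ℝ, H') 𝓘(ℝ, H') ψ (b x) (mfderiv 𝓘(ℝ, H) 𝓘(ℝ, H') b x u) := by
    intro u
    have key : ∀ x', x' = x → mfderiv 𝓘(ℝ, H') 𝓘(ℝ, H') ψ (b x')
        (mfderiv 𝓘(ℝ, H) 𝓘(ℝ, H') b x' u) =
        mfderiv 𝓘(ℝ, H') 𝓘(ℝ, H') ψ (b x) (mfderiv 𝓘(ℝ, H) 𝓘(ℝ, H') b x u) := by
      rintro _ rfl; rfl
    refine (hderiv (χ x) (mem_extChartAt_target x) (by rwa [hxs]) _).trans (Eq.trans ?_ (key _ hxs))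
    exact congrArg (fun u' : H => (mfderiv 𝓘(ℝ, H') 𝓘(ℝ, H') ψ (b (χ.symm (χ x)))
      (mfderiv 𝓘(ℝ, H) 𝓘(ℝ, H') b (χ.symm (χ x)) u') : H'))
      (mfderiv_chart_symm_apply (mem_extChartAt_source x) u)
  have h := flatD_pullback (β := formInChart β q) (by rwa [hgx]) hgs
    (mfderiv 𝓘(ℝ, H) 𝓘(ℝ, H) χ x v) (mfderiv 𝓘(ℝ, H) 𝓘(ℝ, H) χ x w)
  rw [hgx] at h
  exact (dExt_eq_flatD α x v w).trans ((flatD_congr heq _ _).trans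
    (h.trans (congrArg₂ (flatD (formInChart β q) (ψ (b x))) (hder v) (hder w))))

/-- The exterior derivative of `α`, computed in the chart around an arbitrary point `p`. -/
lemma dExt_chart_symm {α : OneForm H X} {p : X} {y : H}
    (hy : y ∈ (extChartAt 𝓘(ℝ, H) p).target) (hα : DifferentiableAt ℝ (formInChart α p) y)
    (v w : H) :
    dExt α ((extChartAt 𝓘(ℝ, H) p).symm y)
      (mfderiv 𝓘(ℝ, H) 𝓘(ℝ, H) (extChartAt 𝓘(ℝ, H) p).symm y v)
      (mfderiv 𝓘(ℝ, H) 𝓘(ℝ, H) (extChartAt 𝓘(ℝ, H) p).symm y w) =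
      flatD (formInChart α p) y v w := by
  have hr := (extChartAt 𝓘(ℝ, H) p).right_inv hy
  rw [dExt_pullback (b := id) (q := p) contMDiff_id ((extChartAt 𝓘(ℝ, H) p).map_target hy)
    (β := α) (Filter.Eventually.of_forall fun z => ?_) (by rwa [id_eq, hr])]
  · simp only [mfderiv_id, id_eq, hr]
    congr 1
    · exact mfderiv_chart_chart_symm hy v
    · exact mfderiv_chart_chart_symm hy w
  · rw [mfderiv_id]; rfl

variable {V : Type*} [NormedAddCommGroup V] [NormedSpace ℝ V]

variable (H) in
/-- Smoothness on `W` of a `V`-valued form `Φ` on `TB` along a map `b : X → B`, tested on smooth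
families of tangent vectors parametrized by subsets of the model space of `X`. No topology on the
total space of `Hom(TB, V)` enters. -/
structure SmoothAlong (W : Set X) (b : X → B)
    (Φ : ∀ x : X, TangentSpace 𝓘(ℝ, H') (b x) →L[ℝ] V) : Prop where
  base : ContMDiffOn 𝓘(ℝ, H) 𝓘(ℝ, H') ∞ b W
  apply : ∀ (T : Set H) (s : H → X) (v : ∀ y, TangentSpace 𝓘(ℝ, H') (b (s y))),
    ContMDiffOn 𝓘(ℝ, H) 𝓘(ℝ, H) ∞ s T → Set.MapsTo s T W →
    ContMDiffOn 𝓘(ℝ, H) 𝓘(ℝ, H').tangent ∞ (fun y => (⟨b (s y), v y⟩ : TangentBundle 𝓘(ℝ, H') B)) T →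
    ContDiffOn ℝ ∞ (fun y => (Φ (s y) (v y) : V)) T

/-- A smooth one-form is smooth when tested on smooth families of tangent vectors. -/
lemma SmoothFormOn.smoothAlong {α : ∀ x : X, TangentSpace 𝓘(ℝ, H) x →L[ℝ] V} {W : Set X}
    (hα : SmoothFormOn W α) : SmoothAlong H W (id : X → X) α where
  base := contMDiffOn_id
  apply T s v hs hsT hv := by
    have key := ContMDiffOn.clm_bundle_apply (E₁ := (TangentSpace 𝓘(ℝ, H) : X → Type _))
      (E₂ := Bundle.Trivial X V) (F₂ := V) (b := s) (ϕ := fun y => α (s y)) (v := v)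
      (hα.comp hs hsT) hv
    exact fun y hy => contMDiffWithinAt_iff_contDiffWithinAt.1
      (contMDiffWithinAt_totalSpace.1 (key y hy)).2

variable [FiniteDimensional ℝ H]

/-- The expression in a chart of the pulled back form `Φ ∘ db` is smooth. -/
lemma contDiffOn_pullback_chart {b : X → B} {Φ : ∀ x : X, TangentSpace 𝓘(ℝ, H') (b x) →L[ℝ] V}
    {W : Set X} (hW : IsOpen W) (hΦ : SmoothAlong H W b Φ) (p : X) :
    ContDiffOn ℝ ∞ (fun y : H => (((Φ ((extChartAt 𝓘(ℝ, H) p).symm y)).comp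
        (mfderiv 𝓘(ℝ, H) 𝓘(ℝ, H') b ((extChartAt 𝓘(ℝ, H) p).symm y))).comp
        (mfderiv 𝓘(ℝ, H) 𝓘(ℝ, H) (extChartAt 𝓘(ℝ, H) p).symm y) : H →L[ℝ] V))
      ((extChartAt 𝓘(ℝ, H) p).target ∩ (extChartAt 𝓘(ℝ, H) p).symm ⁻¹' W) := by
  set T := (extChartAt 𝓘(ℝ, H) p).target ∩ (extChartAt 𝓘(ℝ, H) p).symm ⁻¹' W with hT
  have hTo : IsOpen T := (continuousOn_extChartAt_symm p).isOpen_inter_preimage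
    (isOpen_extChartAt_target p) hW
  have hs : ContMDiffOn 𝓘(ℝ, H) 𝓘(ℝ, H) ∞ (extChartAt 𝓘(ℝ, H) p).symm T :=
    (contMDiffOn_extChartAt_symm p).mono Set.inter_subset_left
  have hg : ContMDiffOn 𝓘(ℝ, H) 𝓘(ℝ, H') ∞ (b ∘ (extChartAt 𝓘(ℝ, H) p).symm) T :=
    hΦ.base.comp hs fun y hy => hy.2
  have : IsManifold 𝓘(ℝ, H') 1 B := .of_le (n := ∞) (by simp)
  rw [contDiffOn_clm_apply]
  intro v
  have hv : ContMDiffOn 𝓘(ℝ, H) 𝓘(ℝ, H').tangent ∞ (fun y : H => tangentMapWithin 𝓘(ℝ, H) 𝓘(ℝ, H')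
      (b ∘ (extChartAt 𝓘(ℝ, H) p).symm) T (⟨y, v⟩ : TangentBundle 𝓘(ℝ, H) H)) T := by
    refine (hg.contMDiffOn_tangentMapWithin (m := ∞) (by simp) hTo.uniqueMDiffOn).comp
      (s := T) ?_ fun y hy => hy
    exact contMDiffOn_vectorSpace_iff_contDiffOn.2 contDiffOn_const
  have key := hΦ.apply T (extChartAt 𝓘(ℝ, H) p).symm
    (fun y => mfderivWithin 𝓘(ℝ, H) 𝓘(ℝ, H') (b ∘ (extChartAt 𝓘(ℝ, H) p).symm) T y v)
    hs (fun y hy => hy.2) hv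
  refine key.congr fun z hz => ?_
  have hc : mfderivWithin 𝓘(ℝ, H) 𝓘(ℝ, H') (b ∘ (extChartAt 𝓘(ℝ, H) p).symm) T z v =
      mfderiv 𝓘(ℝ, H) 𝓘(ℝ, H') b ((extChartAt 𝓘(ℝ, H) p).symm z)
        (mfderiv 𝓘(ℝ, H) 𝓘(ℝ, H) (extChartAt 𝓘(ℝ, H) p).symm z v) := by
    rw [mfderivWithin_of_isOpen hTo hz, mfderiv_comp z
      ((hΦ.base.contMDiffAt (hW.mem_nhds hz.2)).mdifferentiableAt (by simp))
      (mdifferentiableAt_chart_symm hz.1)]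
    rfl
  exact (congrArg (Φ _) hc).symm

end Charts

/-! ### Smoothness and Lie derivatives in charts -/

section LieDerivative

variable {H : Type*} [NormedAddCommGroup H] [NormedSpace ℝ H]
variable {X : Type*} [TopologicalSpace X] [ChartedSpace H X] [IsManifold 𝓘(ℝ, H) ∞ X]

lemma contDiffOn_fieldInChart {Y : VField H X} (hY : SmoothVField Y) (p : X) :
    ContDiffOn ℝ ∞ (fieldInChart Y p) (extChartAt 𝓘(ℝ, H) p).target := by
  have : IsManifold 𝓘(ℝ, H) 1 X := .of_le (n := ∞) (by simp)
  have h1 : ContMDiffOn 𝓘(ℝ, H) 𝓘(ℝ, H) ∞ (extChartAt 𝓘(ℝ, H) p)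
      (extChartAt 𝓘(ℝ, H) p).source := by
    rw [extChartAt_source]; exact contMDiffOn_extChartAt
  have h2 := h1.contMDiffOn_tangentMapWithin (m := ∞) (by simp)
    (isOpen_extChartAt_source p).uniqueMDiffOn
  have h3 := h2.comp (hY.comp_contMDiffOn (contMDiffOn_extChartAt_symm p))
    fun y hy => (extChartAt 𝓘(ℝ, H) p).map_target hy
  have h4 := (contMDiff_snd_tangentBundle_modelSpace H 𝓘(ℝ, H)).comp_contMDiffOn h3
  refine (contMDiffOn_iff_contDiffOn.1 h4).congr fun y hy => ?_
  have : mfderivWithin 𝓘(ℝ, H) 𝓘(ℝ, H) (extChartAt 𝓘(ℝ, H) p) (extChartAt 𝓘(ℝ, H) p).source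
      ((extChartAt 𝓘(ℝ, H) p).symm y) =
      mfderiv 𝓘(ℝ, H) 𝓘(ℝ, H) (extChartAt 𝓘(ℝ, H) p) ((extChartAt 𝓘(ℝ, H) p).symm y) :=
    mfderivWithin_of_isOpen (isOpen_extChartAt_source p) ((extChartAt 𝓘(ℝ, H) p).map_target hy)
  exact (DFunLike.congr_fun this _).symm

lemma contDiffOn_formInChart_pullback [FiniteDimensional ℝ H]
    {H' : Type*} [NormedAddCommGroup H'] [NormedSpace ℝ H']
    {B : Type*} [TopologicalSpace B] [ChartedSpace H' B] [IsManifold 𝓘(ℝ, H') ∞ B]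
    {V : Type*} [NormedAddCommGroup V] [NormedSpace ℝ V]
    {b : X → B} {Φ : ∀ x : X, TangentSpace 𝓘(ℝ, H') (b x) →L[ℝ] V}
    {W : Set X} (hW : IsOpen W)
    (hΦ : SmoothAlong H W b Φ)
    (L : V →L[ℝ] ℝ) (p : X) :
    ContDiffOn ℝ ∞ (formInChart
        (fun x => L.comp ((Φ x).comp (mfderiv 𝓘(ℝ, H) 𝓘(ℝ, H') b x))) p)
      ((extChartAt 𝓘(ℝ, H) p).target ∩ (extChartAt 𝓘(ℝ, H) p).symm ⁻¹' W) :=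
  contDiffOn_const.clm_comp (contDiffOn_pullback_chart hW hΦ p)

lemma contDiffOn_formInChart [FiniteDimensional ℝ H] {V : Type*} [NormedAddCommGroup V]
    [NormedSpace ℝ V] {α : ∀ x : X, TangentSpace 𝓘(ℝ, H) x →L[ℝ] V} {W : Set X} (hW : IsOpen W)
    (hα : SmoothFormOn W α) (L : V →L[ℝ] ℝ) (p : X) :
    ContDiffOn ℝ ∞ (formInChart (fun x => L.comp (α x)) p)
      ((extChartAt 𝓘(ℝ, H) p).target ∩ (extChartAt 𝓘(ℝ, H) p).symm ⁻¹' W) := by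
  have h : (fun x => L.comp (α x)) =
      fun x => L.comp ((α x).comp (mfderiv 𝓘(ℝ, H) 𝓘(ℝ, H) (id : X → X) x)) := by
    funext x
    rw [mfderiv_id]
    rfl
  rw [h]
  exact contDiffOn_formInChart_pullback hW hα.smoothAlong L p

lemma differentiableAt_formInChart [FiniteDimensional ℝ H] {V : Type*} [NormedAddCommGroup V]
    [NormedSpace ℝ V] {α : ∀ x : X, TangentSpace 𝓘(ℝ, H) x →L[ℝ] V} {W : Set X} (hW : IsOpen W)
    (hα : SmoothFormOn W α) (L : V →L[ℝ] ℝ) {p : X} (hp : p ∈ W) :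
    DifferentiableAt ℝ (formInChart (fun x => L.comp (α x)) p) (extChartAt 𝓘(ℝ, H) p p) := by
  have ho := (continuousOn_extChartAt_symm (I := 𝓘(ℝ, H)) p).isOpen_inter_preimage
    (isOpen_extChartAt_target p) hW
  refine ((contDiffOn_formInChart hW hα L p).contDiffAt (ho.mem_nhds
    ⟨mem_extChartAt_target p, ?_⟩)).differentiableAt (by simp)
  rwa [Set.mem_preimage, extChartAt_to_inv]

/-- Cartan's formula, for a form whose value on `Y` is constant. -/
lemma lieForm_eq_flatD {α : OneForm H X} {Y : VField H X} {p : X}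
    (hα : DifferentiableAt ℝ (formInChart α p) (extChartAt 𝓘(ℝ, H) p p))
    (hY : SmoothVField Y) {r : ℝ} (hr : ∀ x, α x (Y x) = r) (v : TangentSpace 𝓘(ℝ, H) p) :
    lieForm Y α p v = flatD (formInChart α p) (extChartAt 𝓘(ℝ, H) p p)
      (fieldInChart Y p (extChartAt 𝓘(ℝ, H) p p))
      (mfderiv 𝓘(ℝ, H) 𝓘(ℝ, H) (extChartAt 𝓘(ℝ, H) p) p v) := by
  have hn : (extChartAt 𝓘(ℝ, H) p).target ∈ nhds (extChartAt 𝓘(ℝ, H) p p) :=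
    extChartAt_target_mem_nhds p
  have hY' := ((contDiffOn_fieldInChart hY p).contDiffAt hn).differentiableAt (by simp)
  have h : (fun y => formInChart α p y (fieldInChart Y p y))
      =ᶠ[nhds (extChartAt 𝓘(ℝ, H) p p)] fun _ => r := by
    filter_upwards [hn] with y hy
    rw [formInChart_apply_fieldInChart α Y hy, hr]
  have h0 := h.fderiv_eq (𝕜 := ℝ)
  rw [fderiv_clm_apply hα hY', fderiv_fun_const] at h0
  have h1 : ∀ u : H, formInChart α p (extChartAt 𝓘(ℝ, H) p p)
      (fderiv ℝ (fieldInChart Y p) (extChartAt 𝓘(ℝ, H) p p) u) +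
      fderiv ℝ (formInChart α p) (extChartAt 𝓘(ℝ, H) p p) u
        (fieldInChart Y p (extChartAt 𝓘(ℝ, H) p p)) = 0 := fun u => DFunLike.congr_fun h0 u
  unfold lieForm flatD
  linear_combination h1 (mfderiv 𝓘(ℝ, H) 𝓘(ℝ, H) (extChartAt 𝓘(ℝ, H) p) p v)

lemma lieFun_eq_fderiv {g : X → ℝ} {p : X} (hg : MDifferentiableAt 𝓘(ℝ, H) 𝓘(ℝ, ℝ) g p)
    (Y : VField H X) : lieFun Y g p =
      fderiv ℝ (fun y => g ((extChartAt 𝓘(ℝ, H) p).symm y)) (extChartAt 𝓘(ℝ, H) p p)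
        (fieldInChart Y p (extChartAt 𝓘(ℝ, H) p p)) := by
  have hx : (extChartAt 𝓘(ℝ, H) p).symm (extChartAt 𝓘(ℝ, H) p p) = p := extChartAt_to_inv p
  have key : ∀ x', x' = p → lieFun Y g x' = lieFun Y g p := by rintro _ rfl; rfl
  have h1 : fderiv ℝ (fun y => g ((extChartAt 𝓘(ℝ, H) p).symm y)) (extChartAt 𝓘(ℝ, H) p p) =
      mfderiv 𝓘(ℝ, H) 𝓘(ℝ, ℝ) (g ∘ (extChartAt 𝓘(ℝ, H) p).symm) (extChartAt 𝓘(ℝ, H) p p) :=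
    mfderiv_eq_fderiv.symm
  rw [h1, mfderiv_comp _ (by rwa [hx]) (mdifferentiableAt_chart_symm (mem_extChartAt_target p)),
    ← key _ hx]
  exact (congrArg (mfderiv 𝓘(ℝ, H) 𝓘(ℝ, ℝ) g _)
    (mfderiv_chart_symm_chart (mem_extChartAt_target p) _)).symm

end LieDerivative

/-! ### The Reeb flow in constant flag curvature -/

section Core

variable {H : Type*} [NormedAddCommGroup H] [NormedSpace ℝ H] [FiniteDimensional ℝ H]
variable {X : Type*} [TopologicalSpace X] [ChartedSpace H X] [IsManifold 𝓘(ℝ, H) ∞ X]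
variable {n : ℕ} {om₀ : OneForm H X} {om th₀ : Fin n → OneForm H X}
  {θ : Fin n → Fin n → OneForm H X} {I : Fin n → Fin n → Fin n → X → ℝ}
  {E : VField H X} {e f : Fin n → VField H X}

/-- The structure equations on `X`, transported to a chart. -/
lemma flatStructure_chart
    (h₀ : ∀ p, ContDiffOn ℝ ∞ (formInChart om₀ p) (extChartAt 𝓘(ℝ, H) p).target)
    (h₁ : ∀ i p, ContDiffOn ℝ ∞ (formInChart (om i) p) (extChartAt 𝓘(ℝ, H) p).target)
    (h₂ : ∀ i p, ContDiffOn ℝ ∞ (formInChart (th₀ i) p) (extChartAt 𝓘(ℝ, H) p).target)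
    (hd : ∀ x v w, dExt om₀ x v w = -∑ j, wedge (th₀ j x) (om j x) v w)
    (hθ : IsConnection Set.univ om₀ om th₀ θ I) (hE : IsDualFrame om₀ om th₀ θ E e f) (p : X) :
    FlatStructure (extChartAt 𝓘(ℝ, H) p).target (formInChart om₀ p) (fun i => formInChart (om i) p)
      (fun i => formInChart (th₀ i) p) (fun i j => formInChart (θ i j) p)
      (fun i j k y => I i j k ((extChartAt 𝓘(ℝ, H) p).symm y)) (fieldInChart E p)
      (fun i => fieldInChart (e i) p) (fun i => fieldInChart (f i) p) where
  isOpen := isOpen_extChartAt_target p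
  smooth_a₀ := h₀ p
  smooth_a i := h₁ i p
  smooth_b i := h₂ i p
  smooth_t i j := by
    have := contDiffOn_formInChart isOpen_univ (hθ.smooth_form i j) (ContinuousLinearMap.id ℝ ℝ) p
    rwa [Set.preimage_univ, Set.inter_univ] at this
  smooth_I i j k := contMDiffOn_iff_contDiffOn.1
    ((hθ.smooth_fun i j k).comp (contMDiffOn_extChartAt_symm p) fun _ _ => Set.mem_univ _)
  smooth_E := contDiffOn_fieldInChart hE.smooth_E p
  smooth_e i := contDiffOn_fieldInChart (hE.smooth_e i) p
  smooth_f i := contDiffOn_fieldInChart (hE.smooth_f i) p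
  a₀_E y hy := by rw [formInChart_apply_fieldInChart _ _ hy, hE.omega0_E]
  a_E y hy i := by rw [formInChart_apply_fieldInChart _ _ hy, hE.omega_E]
  b_E y hy i := by rw [formInChart_apply_fieldInChart _ _ hy, hE.theta0_E]
  t_E y hy i j := by rw [formInChart_apply_fieldInChart _ _ hy, hE.theta_E]
  a₀_e y hy j := by rw [formInChart_apply_fieldInChart _ _ hy, hE.omega0_e]
  a_e y hy i j := by rw [formInChart_apply_fieldInChart _ _ hy, hE.omega_e]
  b_e y hy i j := by rw [formInChart_apply_fieldInChart _ _ hy, hE.theta0_e]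
  t_e y hy i k j := by rw [formInChart_apply_fieldInChart _ _ hy, hE.theta_e]
  a₀_f y hy j := by rw [formInChart_apply_fieldInChart _ _ hy, hE.omega0_f]
  a_f y hy i j := by rw [formInChart_apply_fieldInChart _ _ hy, hE.omega_f]
  b_f y hy i j := by rw [formInChart_apply_fieldInChart _ _ hy, hE.theta0_f]
  t_f y hy i k j := by rw [formInChart_apply_fieldInChart _ _ hy, hE.theta_f]
  skew y hy i j := by
    ext v
    exact DFunLike.congr_fun (hθ.skew i j ((extChartAt 𝓘(ℝ, H) p).symm y) (Set.mem_univ _)) _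
  symm y hy i j k := hθ.symm i j k _ (Set.mem_univ _)
  d_a₀ y hy v w := by
    rw [← dExt_chart_symm hy (((h₀ p).contDiffAt
      ((isOpen_extChartAt_target p).mem_nhds hy)).differentiableAt (by simp)), hd]
    rfl
  d_a y hy i v w := by
    rw [← dExt_chart_symm hy (((h₁ i p).contDiffAt
      ((isOpen_extChartAt_target p).mem_nhds hy)).differentiableAt (by simp)),
      hθ.d_omega i _ (Set.mem_univ _)]
    rfl

omit [FiniteDimensional ℝ H] in
lemma dExt_fields_chart {α : OneForm H X} {p : X} (Y Z : VField H X) {y : H}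
    (hy : y ∈ (extChartAt 𝓘(ℝ, H) p).target)
    (hα : ContDiffOn ℝ ∞ (formInChart α p) (extChartAt 𝓘(ℝ, H) p).target) :
    dExt α ((extChartAt 𝓘(ℝ, H) p).symm y) (Y ((extChartAt 𝓘(ℝ, H) p).symm y))
      (Z ((extChartAt 𝓘(ℝ, H) p).symm y)) =
      flatD (formInChart α p) y (fieldInChart Y p y) (fieldInChart Z p y) := by
  rw [← dExt_chart_symm hy ((hα.contDiffAt
      ((isOpen_extChartAt_target p).mem_nhds hy)).differentiableAt (by simp))]
  exact congrArg₂ (dExt α _) (mfderiv_chart_symm_chart hy _).symm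
    (mfderiv_chart_symm_chart hy _).symm

/-- Polarization: a symmetric matrix with quadratic form `c |s|²` is `c` times the identity. -/
lemma curv_of_quadratic {n : ℕ} {R : Fin n → Fin n → ℝ} (hR : ∀ i j, R i j = R j i) {c : ℝ}
    (hc : ∀ s : Fin n → ℝ, ∑ i, ∑ j, R i j * (s i * s j) = c * ∑ i, s i ^ 2) (i j : Fin n) :
    R i j = if i = j then c else 0 := by
  have hd : ∀ i, R i i = c := fun i => by
    have := hc (fun k => if k = i then 1 else 0)
    simpa using this
  rcases eq_or_ne i j with rfl | hij
  · simp [hd]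
  · have := hc (fun k => (if k = i then 1 else 0) + if k = j then 1 else 0)
    simp [mul_add, Finset.sum_add_distrib, add_sq, hij.symm, hd, hR j i] at this
    simp [hij]
    linarith

/-- The identities for the Lie derivatives along `E` on any manifold with forms and functions that
satisfy the structure equations of constant flag curvature. -/
theorem reeb_identities
    (h₀ : ∀ p, ContDiffOn ℝ ∞ (formInChart om₀ p) (extChartAt 𝓘(ℝ, H) p).target)
    (h₁ : ∀ i p, ContDiffOn ℝ ∞ (formInChart (om i) p) (extChartAt 𝓘(ℝ, H) p).target)
    (h₂ : ∀ i p, ContDiffOn ℝ ∞ (formInChart (th₀ i) p) (extChartAt 𝓘(ℝ, H) p).target)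
    (hd : ∀ x v w, dExt om₀ x v w = -∑ j, wedge (th₀ j x) (om j x) v w)
    (hθ : IsConnection Set.univ om₀ om th₀ θ I) (hE : IsDualFrame om₀ om th₀ θ E e f)
    {c : ℝ} (hc : HasConstFlagCurvature om th₀ E e c) :
    (∀ i x v, lieForm E (om i) x v = -th₀ i x v) ∧
    (∀ i x v, lieForm E (th₀ i) x v = c * om i x v) ∧
    (∀ i j k x, lieFun E (I i j k) x = coeffJ th₀ e f i j k x) ∧
    (∀ i j k, MDifferentiable 𝓘(ℝ, H) 𝓘(ℝ, ℝ) (coeffJ th₀ e f i j k)) ∧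
    (∀ i j k x, lieFun E (coeffJ th₀ e f i j k) x = -c * I i j k x) ∧
    (∀ i j k x, curvR0 th₀ e i j k x = 0) ∧
    (∀ i j x v, lieForm E (θ i j) x v = 0) ∧
    (∀ i j k x, coeffJ th₀ e f i j k x = coeffJ th₀ e f j i k x ∧
      coeffJ th₀ e f i j k x = coeffJ th₀ e f i k j x) := by
  have S := flatStructure_chart h₀ h₁ h₂ hd hθ hE
  have hx : ∀ p : X, (extChartAt 𝓘(ℝ, H) p).symm (extChartAt 𝓘(ℝ, H) p p) = p :=
    fun p => extChartAt_to_inv p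
  have hm : ∀ p : X, extChartAt 𝓘(ℝ, H) p p ∈ (extChartAt 𝓘(ℝ, H) p).target :=
    fun p => mem_extChartAt_target p
  have hJ : ∀ i j k p, ∀ y ∈ (extChartAt 𝓘(ℝ, H) p).target,
      coeffJ th₀ e f i j k ((extChartAt 𝓘(ℝ, H) p).symm y) =
        flatD (formInChart (th₀ i) p) y (fieldInChart (f k) p y) (fieldInChart (e j) p y) :=
    fun i j k p y hy => dExt_fields_chart _ _ hy (h₂ i p)
  have hJ' : ∀ i j k p, coeffJ th₀ e f i j k p =
      flatD (formInChart (th₀ i) p) (extChartAt 𝓘(ℝ, H) p p)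
        (fieldInChart (f k) p (extChartAt 𝓘(ℝ, H) p p))
        (fieldInChart (e j) p (extChartAt 𝓘(ℝ, H) p p)) := fun i j k p => by
    rw [← hJ i j k p _ (hm p), hx]
  have hR : ∀ i j p, ∀ y ∈ (extChartAt 𝓘(ℝ, H) p).target,
      curvR00 th₀ E e i j ((extChartAt 𝓘(ℝ, H) p).symm y) =
        flatD (formInChart (th₀ i) p) y (fieldInChart E p y) (fieldInChart (e j) p y) :=
    fun i j p y hy => dExt_fields_chart _ _ hy (h₂ i p)
  have hcurv : ∀ p, ∀ y ∈ (extChartAt 𝓘(ℝ, H) p).target, ∀ i j,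
      flatD (formInChart (th₀ i) p) y (fieldInChart E p y) (fieldInChart (e j) p y) =
        if i = j then c else 0 := fun p y hy i j => by
    rw [← hR i j p y hy]
    refine curv_of_quadratic (R := fun i j => curvR00 th₀ E e i j _) (fun i j => ?_)
      (fun s => ?_) i j
    · simp only [hR _ _ p y hy]
      exact (S p).curv_symm hy i j
    · -- evaluate the quadratic form on the vector `∑ s_k e_k`, whose `ω_i`-components are the `s_i`
      have := hc ((extChartAt 𝓘(ℝ, H) p).symm y)
        (∑ k, s k • e k ((extChartAt 𝓘(ℝ, H) p).symm y))
      have hs : ∀ i, om i ((extChartAt 𝓘(ℝ, H) p).symm y)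
          (∑ k, s k • e k ((extChartAt 𝓘(ℝ, H) p).symm y)) = s i := fun i => by
        refine (map_sum (om i _) _ _).trans ?_
        refine (Finset.sum_congr rfl fun k _ => (om i _).map_smul (s k) _).trans ?_
        simp only [hE.omega_e, smul_eq_mul, mul_ite, mul_one, mul_zero, Finset.sum_ite_eq,
          Finset.mem_univ, if_true]
      simpa only [hs] using this
  have hdiff : ∀ {α : OneForm H X} (p : X),
      ContDiffOn ℝ ∞ (formInChart α p) (extChartAt 𝓘(ℝ, H) p).target →
      DifferentiableAt ℝ (formInChart α p) (extChartAt 𝓘(ℝ, H) p p) := fun p h =>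
    (S p).diff h (hm p)
  have hJd : ∀ i j k, MDifferentiable 𝓘(ℝ, H) 𝓘(ℝ, ℝ) (coeffJ th₀ e f i j k) := by
    intro i j k p
    have h1 := differentiableAt_flatD
      (((S p).smooth_b i).contDiffAt ((S p).isOpen.mem_nhds (hm p)))
      ((S p).diff ((S p).smooth_f k) (hm p)) ((S p).diff ((S p).smooth_e j) (hm p))
    have h2 := MDifferentiableAt.comp (I' := 𝓘(ℝ, H)) p h1.mdifferentiableAt
      (mdifferentiableAt_chart (mem_extChartAt_source p))
    refine h2.congr_of_eventuallyEq ?_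
    filter_upwards [(isOpen_extChartAt_source (I := 𝓘(ℝ, H)) p).mem_nhds
      (mem_extChartAt_source p)] with x hxs
    have := hJ i j k p _ ((extChartAt 𝓘(ℝ, H) p).map_source hxs)
    rwa [(extChartAt 𝓘(ℝ, H) p).left_inv hxs] at this
  refine ⟨fun i p v => ?_, fun i p v => ?_, fun i j k p => ?_, hJd, fun i j k p => ?_,
    fun i j k p => ?_, fun i j p v => ?_, fun i j k p => ⟨?_, ?_⟩⟩
  · rw [lieForm_eq_flatD (hdiff p (h₁ i p)) hE.smooth_E (hE.omega_E i)]
    refine ((S p).d_a_E (hm p) i _).trans ?_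
    exact congrArg Neg.neg (formInChart_apply_chart _ (mem_extChartAt_source p) v)
  · rw [lieForm_eq_flatD (hdiff p (h₂ i p)) hE.smooth_E (hE.theta0_E i)]
    refine ((S p).d_b_E (hcurv p) (hm p) i _).trans ?_
    exact congrArg (c * ·) (formInChart_apply_chart _ (mem_extChartAt_source p) v)
  · rw [lieFun_eq_fderiv (((hθ.smooth_fun i j k).contMDiffAt Filter.univ_mem).mdifferentiableAt
      (by simp)), (S p).fderiv_I_E (hm p), hJ']
  · rw [lieFun_eq_fderiv (hJd i j k p), Filter.EventuallyEq.fderiv_eq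
      (Filter.eventually_of_mem ((S p).isOpen.mem_nhds (hm p)) (hJ i j k p)),
      (S p).fderiv_J_E (hcurv p) (hm p), hx]
  · have := dExt_fields_chart (e j) (e k) (hm p) (h₂ i p)
    rw [(S p).curv_eq_zero (hcurv p) (hm p), hx] at this
    exact this
  · rw [lieForm_eq_flatD (hdiff p ((S p).smooth_t i j)) hE.smooth_E (hE.theta_E i j)]
    exact (S p).d_t_E (hcurv p) (hm p) i j _
  · rw [hJ', hJ']
    exact (S p).J_symm (hm p) i j k
  · rw [hJ', hJ']
    exact (S p).J_symm_right (hm p) i j k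

end Core

/-! ### The tautological forms on the structure bundle -/

section Taut

variable {n : ℕ}
variable {M : Type*} [TopologicalSpace M] [ChartedSpace (EuclideanSpace ℝ (Fin (n + 1))) M]
  [IsManifold (𝓡 (n + 1)) ∞ M]
variable {S : Type*} [TopologicalSpace S] [ChartedSpace (EuclideanSpace ℝ (Fin (2 * n + 1))) S]
  [IsManifold (𝓡 (2 * n + 1)) ∞ S]
variable {ι : S → TangentBundle (𝓡 (n + 1)) M}
  [ChartedSpace (EuclideanSpace ℝ (Fin (bundleDim n))) (structureBundle ι)]
  [IsManifold (𝓡 (bundleDim n)) ∞ (structureBundle ι)]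

omit [IsManifold (𝓡 (bundleDim n)) ∞ (structureBundle ι)] in
/-- The coframe `φ`, as a form on `TS` along the projection `F → S`, depends smoothly
on `φ ∈ F`. -/
lemma smoothAlong_coframe
    (hF : ContMDiff (𝓡 (bundleDim n)) (homModel n) ∞
      (Subtype.val : structureBundle ι → HomBundle n S)) :
    SmoothAlong (EuclideanSpace ℝ (Fin (bundleDim n))) Set.univ (fun ψ : structureBundle ι => ψ.1.proj)
      (fun ψ => (ψ.1.2 : TangentSpace (𝓡 (2 * n + 1)) ψ.1.proj →L[ℝ] CoframeSpace n)) where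
  base := ((contMDiff_proj _).comp hF).contMDiffOn
  apply T s v hs _ hv := by
    have key := ContMDiffOn.clm_bundle_apply (E₁ := (TangentSpace (𝓡 (2 * n + 1)) : S → Type _))
      (E₂ := Bundle.Trivial S (CoframeSpace n)) (F₂ := CoframeSpace n) (b := fun y => (s y).1.proj)
      (ϕ := fun y => (s y).1.2) (v := v) (hF.comp_contMDiffOn hs) hv
    exact fun y hy => contMDiffWithinAt_iff_contDiffWithinAt.1
      (contMDiffWithinAt_totalSpace.1 (key y hy)).2

/-- The components of the tautological form are smooth. -/
lemma contDiffOn_tautForm_component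
    (hF : ContMDiff (𝓡 (bundleDim n)) (homModel n) ∞
      (Subtype.val : structureBundle ι → HomBundle n S)) (L : CoframeSpace n →L[ℝ] ℝ)
    (p : structureBundle ι) :
    ContDiffOn ℝ ∞ (formInChart (fun φ : structureBundle ι => L.comp (tautForm ι φ)) p)
      (extChartAt (𝓡 (bundleDim n)) p).target := by
  have h := contDiffOn_formInChart_pullback isOpen_univ (smoothAlong_coframe hF) L p
  rwa [Set.preimage_univ, Set.inter_univ] at h

/-- `dω_0 = -θ_{0j} ∧ ω_j` on `F`: the form `ω_0` on `F` is the pull-back of the Hilbert form,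
for which this equation holds in any local adapted coframing. -/
lemma dExt_omega0
    (hF : ContMDiff (𝓡 (bundleDim n)) (homModel n) ∞
      (Subtype.val : structureBundle ι → HomBundle n S)) (φ : structureBundle ι)
    (v w : TangentSpace (𝓡 (bundleDim n)) φ) :
    dExt (omega0 ι) φ v w = -∑ j, wedge (theta0 ι j φ) (omega ι j φ) v w := by
  obtain ⟨U, η, hη, hφU, hφ⟩ := φ.2
  have hb : ContMDiff (𝓡 (bundleDim n)) (𝓡 (2 * n + 1)) ∞
      (fun ψ : structureBundle ι => ψ.1.proj) := (contMDiff_proj _).comp hF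
  -- The first component of every coframe in `F` is the Hilbert form, which is that of `η` near `φ`.
  have hα : ∀ᶠ ψ in nhds φ, omega0 ι ψ = ((proj0 n).comp (η ψ.1.proj)).comp
      (mfderiv (𝓡 (bundleDim n)) (𝓡 (2 * n + 1)) (fun ψ : structureBundle ι => ψ.1.proj) ψ) := by
    filter_upwards [hb.continuous.continuousAt.preimage_mem_nhds (hη.isOpen.mem_nhds hφU)] with ψ hψ
    obtain ⟨U', η', hη', hψU', hψ'⟩ := ψ.2
    have h1 : (proj0 n).comp (ψ.1.2 : TangentSpace (𝓡 (2 * n + 1)) ψ.1.proj →L[ℝ] CoframeSpace n) =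
        (proj0 n).comp (η ψ.1.proj) := by
      rw [hψ', hη'.hilbert _ hψU', hη.hilbert _ hψ]
    exact congrArg (fun ξ => ContinuousLinearMap.comp ξ (mfderiv (𝓡 (bundleDim n)) (𝓡 (2 * n + 1))
      (fun ψ : structureBundle ι => ψ.1.proj) ψ)) h1
  have hsm := differentiableAt_formInChart hη.isOpen hη.smooth (proj0 n) hφU
  rw [dExt_pullback hb (q := φ.1.proj) (β := fun s => (proj0 n).comp (η s))
    (mem_extChartAt_source _) hα hsm]
  refine (dExt_eq_flatD _ _ _ _).symm.trans ?_
  rw [hη.d_omega0 _ hφU]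
  simp only [theta0, omega, tautForm, hφ]
  rfl

end Taut

end FinslerReeb

theorem mainTheorem9 {n : ℕ}
    {M : Type*} [TopologicalSpace M] [ChartedSpace (EuclideanSpace ℝ (Fin (n + 1))) M]
    [IsManifold (𝓡 (n + 1)) ∞ M]
    {S : Type*} [TopologicalSpace S] [ChartedSpace (EuclideanSpace ℝ (Fin (2 * n + 1))) S]
    [IsManifold (𝓡 (2 * n + 1)) ∞ S]
    -- a generalized Finsler structure `(S, ι)` on `M`
    (ι : S → TangentBundle (𝓡 (n + 1)) M) (_hι : IsGenFinsler ι)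
    -- its `O(n)`-structure `F → S`, as an embedded submanifold of the coframe bundle of `S`
    [ChartedSpace (EuclideanSpace ℝ (Fin (bundleDim n))) (structureBundle ι)]
    [IsManifold (𝓡 (bundleDim n)) ∞ (structureBundle ι)]
    (_hF : Manifold.IsSmoothEmbedding (𝓡 (bundleDim n)) (homModel n) ∞
      (Subtype.val : structureBundle ι → HomBundle n S))
    -- the connection forms `θ i j` and the functions `I i j k` on `F`
    (θ : Fin n → Fin n → OneForm (EuclideanSpace ℝ (Fin (bundleDim n))) (structureBundle ι))
    (I : Fin n → Fin n → Fin n → structureBundle ι → ℝ)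
    (_hθ : IsConnection Set.univ (omega0 ι) (omega ι) (theta0 ι) θ I)
    -- the lifted Reeb field `E` and the fields `e i`, `f i` dual to `ω i`, `θ_{0i}`
    (E : VField (EuclideanSpace ℝ (Fin (bundleDim n))) (structureBundle ι))
    (e f : Fin n → VField (EuclideanSpace ℝ (Fin (bundleDim n))) (structureBundle ι))
    (_hE : IsDualFrame (omega0 ι) (omega ι) (theta0 ι) θ E e f)
    (c : ℝ) (_hc : HasConstFlagCurvature (omega ι) (theta0 ι) E e c) :
    (∀ i φ v, lieForm E (omega ι i) φ v = -theta0 ι i φ v) ∧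
    (∀ i φ v, lieForm E (theta0 ι i) φ v = c * omega ι i φ v) ∧
    (∀ i j k φ, lieFun E (I i j k) φ = coeffJ (theta0 ι) e f i j k φ) ∧
    (∀ i j k, MDifferentiable (𝓡 (bundleDim n)) 𝓘(ℝ, ℝ) (coeffJ (theta0 ι) e f i j k)) ∧
    (∀ i j k φ, lieFun E (coeffJ (theta0 ι) e f i j k) φ = -c * I i j k φ) ∧
    (∀ i j k φ, curvR0 (theta0 ι) e i j k φ = 0) ∧
    (∀ i j φ v, lieForm E (θ i j) φ v = 0) ∧
    (∀ i j k φ, coeffJ (theta0 ι) e f i j k φ = coeffJ (theta0 ι) e f j i k φ ∧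
      coeffJ (theta0 ι) e f i j k φ = coeffJ (theta0 ι) e f i k j φ) := by
  have hs := _hF.contMDiff
  exact reeb_identities (contDiffOn_tautForm_component hs _)
    (fun _ => contDiffOn_tautForm_component hs _) (fun _ => contDiffOn_tautForm_component hs _)
    (dExt_omega0 hs) _hθ _hE _hc
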